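/- Let $n\ge 2$ and $m\ge 4$ be integers. Let $\mathbb H^n_{\mathbb C}=\{z\in\mathbb C^n : |z|<1\}$ be complex hyperbolic $n$-space, and let $\omega$ be the Kähler form of its $\mathrm{SU}(n,1)$-invariant metric, normalized so that the holomorphic sectional curvature is $-1$. Let $$\mathcal Y=\{Z\in M_m(\mathbb C) : Z^\top=-Z,\ 1_m-Z^\star Z>0\}$$ be the symmetric space of $\mathrm{SO}^\star(2m)$, and let $\omega_{\mathcal Y}$ be the Kähler form of its $\mathrm{SO}^\star(2m)$-invariant metric (up to scale, $\mathrm{Re}\,\mathrm{tr}\bigl((1_m-Z^\star Z)^{-1}V^\star(1_m-ZZ^\star)^{-1}W\bigr)$ for skew-symmetric tangent vectors $V,W$ at $Z$), normalized so that the minimum of the holomorphic sectional curvature is $-1$. Then there is no holomorphic map $f:\mathbb H^n_{\mathbb C}\to\mathcal Y$ such that $f^\star\omega_{\mathcal Y}=\lfloor m/2\rfloor\,\omega$. -/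

import Mathlib

attribute [local instance] Matrix.frobeniusNormedAddCommGroup Matrix.frobeniusNormedSpace

noncomputable section

namespace Hermitian

/-! ### Riemannian curvature in a linear chart

`g x v w` is the value at the point `x` of a Riemannian metric on an open subset of a complex
vector space `E`, evaluated on the (real) tangent vectors `v` and `w`. -/

section Curvature

variable {E : Type*} [NormedAddCommGroup E] [NormedSpace ℂ E]

/-- The derivative at `x` in the direction `u` of the function `y ↦ g y v w`. -/
def metricDeriv (g : E → E → E → ℝ) (x u v w : E) : ℝ :=
  fderiv ℝ (fun y => g y v w) x u

/-- The Christoffel symbol `Γ_x(u, v)` of the Levi-Civita connection of `g`: the vector with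
`g(Γ(u, v), w) = (∂_u g(v, w) + ∂_v g(u, w) - ∂_w g(u, v)) / 2` for all `w`. Where `g x` is
nondegenerate there is at most one such vector (exactly one in finite dimension). -/
def christoffel (g : E → E → E → ℝ) (x u v : E) : E :=
  Classical.epsilon fun Γ : E => ∀ w : E,
    g x Γ w = (metricDeriv g x u v w + metricDeriv g x v u w - metricDeriv g x w u v) / 2

/-- The Riemann curvature `R(u, v) w = ∇_u ∇_v w - ∇_v ∇_u w` for constant fields `u`, `v`, `w`. -/
def riemannCurvature (g : E → E → E → ℝ) (x u v w : E) : E :=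
  fderiv ℝ (fun y => christoffel g y v w) x u - fderiv ℝ (fun y => christoffel g y u w) x v
    + christoffel g x u (christoffel g x v w) - christoffel g x v (christoffel g x u w)

/-- The sectional curvature of the real plane spanned by `u` and `v`. -/
def sectionalCurvature (g : E → E → E → ℝ) (x u v : E) : ℝ :=
  g x (riemannCurvature g x u v v) u / (g x u u * g x v v - g x u v ^ 2)

/-- The holomorphic sectional curvature: the sectional curvature of the complex line `ℂ v`. -/
def holSectionalCurvature (g : E → E → E → ℝ) (x v : E) : ℝ :=
  sectionalCurvature g x v (Complex.I • v)

/-- All the values on `U` of the holomorphic sectional curvature of `g`. -/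
def holSectionalCurvatures (g : E → E → E → ℝ) (U : Set E) : Set ℝ :=
  {κ | ∃ x ∈ U, ∃ v : E, v ≠ 0 ∧ κ = holSectionalCurvature g x v}

/-- The multiple of `g` for which the minimum on `U` of the holomorphic sectional curvature
is `-1` (the curvature of `c g` is `1 / c` times the curvature of `g`). -/
def normalizedMetric (g : E → E → E → ℝ) (U : Set E) (x v w : E) : ℝ :=
  -sInf (holSectionalCurvatures g U) * g x v w

/-- The Kähler form `ω(v, w) = g(i v, w)` of a metric. -/
def kahlerForm (g : E → E → E → ℝ) (x v w : E) : ℝ :=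
  g x (Complex.I • v) w

end Curvature

/-- The pull-back `f^* ω` of a 2-form. -/
def pullback {E F : Type*} [NormedAddCommGroup E] [NormedSpace ℂ E]
    [NormedAddCommGroup F] [NormedSpace ℂ F]
    (f : E → F) (ω : F → F → F → ℝ) (x v w : E) : ℝ :=
  ω (f x) (fderiv ℝ f x v) (fderiv ℝ f x w)

/-! ### Complex hyperbolic space -/

/-- Complex hyperbolic `n`-space, as the unit ball of `ℂ^n`. -/
def complexHyperbolic (n : ℕ) : Set (EuclideanSpace ℂ (Fin n)) :=
  Metric.ball 0 1

/-- The `SU(n,1)`-invariant (Bergman) metric of the ball, scaled to the standard inner product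
at the origin. -/
def ballMetric (n : ℕ) (z v w : EuclideanSpace ℂ (Fin n)) : ℝ :=
  (inner ℂ v w / (1 - (‖z‖ : ℂ) ^ 2)
    + inner ℂ v z * inner ℂ z w / (1 - (‖z‖ : ℂ) ^ 2) ^ 2).re

/-- The Kähler form `ω` of the invariant metric of complex hyperbolic space with holomorphic
sectional curvature `-1`. -/
def hyperbolicForm (n : ℕ) :
    EuclideanSpace ℂ (Fin n) → EuclideanSpace ℂ (Fin n) → EuclideanSpace ℂ (Fin n) → ℝ :=
  kahlerForm (normalizedMetric (ballMetric n) (complexHyperbolic n))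

/-! ### The symmetric space of `SO*(2m)` -/

/-- The space of skew-symmetric complex `m × m` matrices. -/
def skewMatrices (m : ℕ) : Submodule ℂ (Matrix (Fin m) (Fin m) ℂ) where
  carrier := {A | A.transpose = -A}
  add_mem' := by
    intro A B hA hB
    change A.transpose = -A at hA; change B.transpose = -B at hB; change (A + B).transpose = -(A + B)
    rw [Matrix.transpose_add, hA, hB, neg_add]
  zero_mem' := by simp
  smul_mem' := by
    intro c A hA
    change A.transpose = -A at hA; change (c • A).transpose = -(c • A)
    rw [Matrix.transpose_smul, hA, smul_neg]

open scoped ComplexOrder in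
/-- The symmetric space of `SO*(2m)`, as the bounded domain of the skew-symmetric matrices `Z`
with `1 - Z^* Z` positive definite. -/
def soStarDomain (m : ℕ) : Set (skewMatrices m) :=
  {Z | (1 - (Z : Matrix (Fin m) (Fin m) ℂ).conjTranspose * Z).PosDef}

/-- The metric `Re tr ((1 - Z^* Z)⁻¹ V^* (1 - Z Z^*)⁻¹ W)` on the domain of `SO*(2m)`: the
restriction of the `SU(m,m)`-invariant metric, invariant under `SO*(2m)`; it is scaled to
`Re tr (V^* W)` at the origin. -/
def soStarMetric (m : ℕ) (Z V W : skewMatrices m) : ℝ :=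
  (Matrix.trace
    ((1 - (Z : Matrix (Fin m) (Fin m) ℂ).conjTranspose * Z)⁻¹
      * (V : Matrix (Fin m) (Fin m) ℂ).conjTranspose
      * (1 - (Z : Matrix (Fin m) (Fin m) ℂ) * (Z : Matrix (Fin m) (Fin m) ℂ).conjTranspose)⁻¹
      * (W : Matrix (Fin m) (Fin m) ℂ))).re

/-- The Kähler form `ω_Y` of the invariant metric on the symmetric space of `SO*(2m)`, normalized
so that the minimum of the holomorphic sectional curvature is `-1`. -/
def soStarForm (m : ℕ) : skewMatrices m → skewMatrices m → skewMatrices m → ℝ :=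
  kahlerForm (normalizedMetric (soStarMetric m) (soStarDomain m))

end Hermitian

end

open Matrix
open scoped ComplexOrder

set_option linter.unusedSectionVars false

namespace Hermitian

/-! ### Linear algebra of skew-symmetric contractions -/

section SkewContractions

/-! The whole obstruction sits in the derivative of `f` at the origin. Write `Z = f 0` and factor
`(1 - Z Z^*)⁻¹ = S^* S`. Because `Z` is skew-symmetric, `(1 - Z^* Z)⁻¹` is the transpose of this, so
`K v = S (df v) Sᵀ` is a linear map into skew-symmetric matrices; it is the derivative after a
Möbius transformation has moved `Z` to `0`.

Two facts constrain `K`. The Schwarz lemma (`posSemidef_of_hasDirectionalDeriv`) makes `K v` a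
contraction for every unit `v`. The equation between the Kähler forms, evaluated on `v` and `i v`,
prescribes the Hilbert–Schmidt norm of `K v`: the ball metric has curvature `-4` and the metric on
skew matrices has curvature at least `-2` (`skew_trace_le`: singular values of a skew matrix come in
pairs), so `4 ⌊m/2⌋ ≤ 2 tr (K v)^* (K v)`. Set `r = 2 ⌊m/2⌋`, the largest rank of a skew matrix. A
skew contraction with squared norm at least `r` has all singular values `0` or `1`, hence is a
partial isometry (`skew_partial_isometry`).

This is impossible on a complex 2-plane (`no_maximal_skew_pencil`). Let `A`, `B` be the images of
two orthonormal vectors. Polarizing `K K^* K = K` gives `B A^* A + A A^* B = B`. Pairing with `B^*`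
yields two traces that skew symmetry makes equal, so `tr (B A^* A B^*)` is half of `tr (B^* B)`. But
`A^* A` is a projection of corank at most `m - r`, so at most `m - r` of `tr (B^* B)` is lost. Hence
`r / 2 ≤ m - r`, that is `3 r ≤ 2 m`, which fails for `m ≥ 4` (and holds for `m = 3`). -/

lemma conjTranspose_skew {p : Type*} {K : Matrix p p ℂ} (hK : Kᵀ = -K) : Kᴴᵀ = -Kᴴ := by
  rw [← conjTranspose_neg, ← hK]; rfl

/-- A Hermitian matrix whose eigenvalues are all `0` or `1` is idempotent. -/
lemma mul_self_eq_self_of_eigenvalues {p : Type*} [Fintype p] [DecidableEq p]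
    {P : Matrix p p ℂ} (hP : P.IsHermitian)
    (h : ∀ i, hP.eigenvalues i * hP.eigenvalues i = hP.eigenvalues i) : P * P = P := by
  rw [hP.spectral_theorem, ← map_mul, diagonal_mul_diagonal]
  congr 2
  funext i
  simp only [Function.comp]
  exact_mod_cast congrArg (RCLike.ofReal : ℝ → ℂ) (h i)

lemma eigenvalues_le_one {p : Type*} [Fintype p] [DecidableEq p]
    {P : Matrix p p ℂ} (hP : P.IsHermitian) (h : (1 - P).PosSemidef) (i : p) :
    hP.eigenvalues i ≤ 1 := by
  have h1 := h.re_dotProduct_nonneg (hP.eigenvectorBasis i)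
  have h2 : P *ᵥ (hP.eigenvectorBasis i) = hP.eigenvalues i • (hP.eigenvectorBasis i).ofLp :=
    hP.mulVec_eigenvectorBasis i
  have h3 : star (hP.eigenvectorBasis i).ofLp ⬝ᵥ (hP.eigenvectorBasis i).ofLp = 1 := by
    have := hP.eigenvectorBasis.orthonormal.1 i
    have h4 := inner_self_eq_norm_sq_to_K (𝕜 := ℂ) (hP.eigenvectorBasis i)
    rw [this, EuclideanSpace.inner_eq_star_dotProduct, dotProduct_comm] at h4
    simpa using h4
  rw [sub_mulVec, one_mulVec, h2, dotProduct_sub, dotProduct_smul, h3] at h1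
  simp at h1
  exact h1

/-- A skew-symmetric contraction of maximal Hilbert–Schmidt norm is a partial isometry. -/
lemma skew_partial_isometry {m : ℕ} {K : Matrix (Fin m) (Fin m) ℂ} (hK : Kᵀ = -K)
    (hc : (1 - Kᴴ * K).PosSemidef) (htr : ((2 * (m / 2) : ℕ) : ℝ) ≤ (Kᴴ * K).trace.re) :
    K * Kᴴ * K = K := by
  have hP : (Kᴴ * K).IsHermitian := isHermitian_conjTranspose_mul_self K
  set e := hP.eigenvalues with he
  have h0 : ∀ i, 0 ≤ e i := eigenvalues_conjTranspose_mul_self_nonneg K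
  have h1 : ∀ i, e i ≤ 1 := eigenvalues_le_one hP hc
  have hs : ((2 * (m / 2) : ℕ) : ℝ) ≤ ∑ i, e i := by
    rw [hP.trace_eq_sum_eigenvalues] at htr
    simpa [Complex.re_sum] using htr
  have hone : ∀ i, e i * e i = e i := by
    rcases Nat.even_or_odd m with hm | hm
    · have hm' : 2 * (m / 2) = m := Nat.two_mul_div_two_of_even hm
      rw [hm'] at hs
      have hz : ∑ i, (1 - e i) = 0 := by
        apply le_antisymm
        · simp; linarith
        · exact Finset.sum_nonneg fun i _ => by linarith [h1 i]
      intro i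
      have := (Finset.sum_eq_zero_iff_of_nonneg fun i _ => by linarith [h1 i]).1 hz i
        (Finset.mem_univ i)
      have h : e i = 1 := by linarith
      rw [h, one_mul]
    -- In odd size a skew matrix is singular, so one eigenvalue is `0`; the trace bound `m - 1` then
    -- forces all the others to be `1`.
    · have hdet : K.det = 0 := by
        have h2 : K.det = -K.det := by
          conv_lhs => rw [← det_transpose, hK, det_neg, Fintype.card_fin, hm.neg_one_pow]
          ring
        exact self_eq_neg.1 h2
      have hdet2 : (Kᴴ * K).det = 0 := by rw [det_mul, hdet, mul_zero]
      rw [hP.det_eq_prod_eigenvalues, Finset.prod_eq_zero_iff] at hdet2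
      obtain ⟨j, -, hj⟩ := hdet2
      have hj : e j = 0 := Complex.ofReal_eq_zero.1 hj
      have hm' : 2 * (m / 2) + 1 = m := Nat.two_mul_div_two_add_one_of_odd hm
      have hm2 : ((2 * (m / 2) : ℕ) : ℝ) = m - 1 := by
        have : ((2 * (m / 2) + 1 : ℕ) : ℝ) = m := by rw [hm']
        push_cast at this ⊢
        linarith
      rw [hm2] at hs
      have hsum : ∑ i ∈ Finset.univ.erase j, (1 - e i) = 0 := by
        apply le_antisymm
        · have := Finset.add_sum_erase Finset.univ (fun i => 1 - e i) (Finset.mem_univ j)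
          simp only [hj, Finset.sum_sub_distrib (f := fun _ : Fin m => (1 : ℝ)) (s := Finset.univ),
            Finset.sum_const, Finset.card_univ, Fintype.card_fin, nsmul_eq_mul] at this
          linarith
        · exact Finset.sum_nonneg fun i _ => by linarith [h1 i]
      intro i
      by_cases hij : i = j
      · rw [hij, hj, zero_mul]
      · have := (Finset.sum_eq_zero_iff_of_nonneg fun i _ => by linarith [h1 i]).1 hsum i
          (Finset.mem_erase.2 ⟨hij, Finset.mem_univ i⟩)
        have h : e i = 1 := by linarith
        rw [h, one_mul]
  have hPP := mul_self_eq_self_of_eigenvalues hP hone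
  have h : (K * Kᴴ * K - K)ᴴ * (K * Kᴴ * K - K) = 0 := by
    have h2 : (K * Kᴴ * K - K)ᴴ * (K * Kᴴ * K - K)
        = Kᴴ * K * (Kᴴ * K) * (Kᴴ * K) - Kᴴ * K * (Kᴴ * K) - (Kᴴ * K * (Kᴴ * K) - Kᴴ * K) := by
      simp only [conjTranspose_sub, conjTranspose_mul, conjTranspose_conjTranspose]
      noncomm_ring
    rw [h2, hPP, hPP]
    simp
  exact sub_eq_zero.1 (conjTranspose_mul_self_eq_zero.1 h)

/-- With `q = 1 - A^* A`, a projection, compressing `B^* B ≤ 1` by `q` gives `tr (B q B^*) ≤ tr q`: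
the complement of the initial space of `A` can absorb at most its dimension. -/
lemma trace_mul_projection_le {p : Type*} [Fintype p] [DecidableEq p] {A B : Matrix p p ℂ}
    (hA : A * Aᴴ * A = A) (hB : (1 - Bᴴ * B).PosSemidef) :
    (Bᴴ * B).trace.re - (Fintype.card p - (Aᴴ * A).trace.re) ≤ (B * Aᴴ * A * Bᴴ).trace.re := by
  obtain ⟨q, hq⟩ : ∃ q, q = 1 - Aᴴ * A := ⟨_, rfl⟩
  have hqh : qᴴ = q := by simp [hq, conjTranspose_sub, conjTranspose_mul]
  have hqq : q * q = q := by
    have : q * q = 1 - Aᴴ * A - Aᴴ * A + Aᴴ * (A * Aᴴ * A) := by rw [hq]; noncomm_ring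
    rw [this, hA, hq]; abel
  have h1 := (hB.conjTranspose_mul_mul_same q).trace_nonneg
  have h2 : (qᴴ * (1 - Bᴴ * B) * q).trace = q.trace - (B * q * Bᴴ).trace := by
    rw [hqh, mul_sub, sub_mul, mul_one, hqq, trace_sub]
    congr 1
    rw [trace_mul_comm, ← mul_assoc, ← mul_assoc, hqq, trace_mul_cycle]
  rw [h2] at h1
  have h3 : (B * q * Bᴴ).trace = (Bᴴ * B).trace - (B * Aᴴ * A * Bᴴ).trace := by
    rw [hq, mul_sub, sub_mul, trace_sub, mul_one, trace_mul_comm, ← mul_assoc B]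
  have h4 : q.trace = Fintype.card p - (Aᴴ * A).trace := by rw [hq, trace_sub, trace_one]
  rw [h3, h4] at h1
  have := (Complex.le_def.1 h1).1
  simp at this
  linarith

/-- For `m ≥ 4`, there is no complex linear pencil of skew-symmetric `m × m` matrices that is
contractive and has maximal Hilbert–Schmidt norm. -/
lemma no_maximal_skew_pencil {m : ℕ} (hm : 4 ≤ m) {A B : Matrix (Fin m) (Fin m) ℂ}
    (hA : Aᵀ = -A) (hB : Bᵀ = -B)
    (hc : ∀ a b : ℂ, ‖a‖ ^ 2 + ‖b‖ ^ 2 = 1 →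
      (1 - (a • A + b • B)ᴴ * (a • A + b • B)).PosSemidef)
    (htr : ∀ a b : ℂ, ‖a‖ ^ 2 + ‖b‖ ^ 2 = 1 →
      ((2 * (m / 2) : ℕ) : ℝ) ≤ ((a • A + b • B)ᴴ * (a • A + b • B)).trace.re) : False := by
  have hpi : ∀ a b : ℂ, ‖a‖ ^ 2 + ‖b‖ ^ 2 = 1 →
      (a • A + b • B) * (a • A + b • B)ᴴ * (a • A + b • B) = a • A + b • B := fun a b hab =>
    skew_partial_isometry (by simp [hA, hB, transpose_add]; abel) (hc a b hab) (htr a b hab)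
  have hcB := hc 0 1 (by simp)
  have htA := htr 1 0 (by simp)
  have htB := htr 0 1 (by simp)
  have hpA := hpi 1 0 (by simp)
  have hpB := hpi 0 1 (by simp)
  simp only [one_smul, zero_smul, add_zero, zero_add] at hcB htA htB hpA hpB
  have hr : ‖(((√2)⁻¹ : ℝ) : ℂ)‖ ^ 2 = 1 / 2 := by
    rw [Complex.norm_real, norm_inv, inv_pow, Real.norm_eq_abs, sq_abs, Real.sq_sqrt (by norm_num)]
    norm_num
  -- The partial isometry equation for `(A + t B) / √2`, cleared of the factor `1 / √2`.
  have key : ∀ t : ℂ, ‖t‖ = 1 →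
      (A + t • B) * (A + t • B)ᴴ * (A + t • B) = (2 : ℂ) • (A + t • B) := by
    intro t ht
    have h := hpi (((√2)⁻¹ : ℝ) : ℂ) (((√2)⁻¹ : ℝ) * t)
      (by rw [norm_mul, mul_pow, hr, ht]; norm_num)
    rw [mul_smul, ← smul_add, conjTranspose_smul] at h
    simp only [Matrix.smul_mul, Matrix.mul_smul, smul_smul] at h
    have hs : (((√2)⁻¹ : ℝ) : ℂ) * (((√2)⁻¹ : ℝ) : ℂ) = 1 / 2 := by
      rw [← Complex.ofReal_mul, ← mul_inv, Real.mul_self_sqrt (by norm_num)]; norm_num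
    have hs0 : (((√2)⁻¹ : ℝ) : ℂ) ≠ 0 := by
      intro h0; rw [h0] at hs; norm_num at hs
    have h2 : star (((√2)⁻¹ : ℝ) : ℂ) = (((√2)⁻¹ : ℝ) : ℂ) := Complex.conj_ofReal _
    rw [h2, mul_assoc, hs, mul_smul] at h
    have h3 := smul_right_injective _ hs0 h
    rw [mul_assoc, ← one_smul ℂ ((A + t • B) * _), show (1 : ℂ) = 2 * (1 / 2) by norm_num, mul_smul,
      h3]
  have k1 := key 1 (by simp)
  have k2 := key (-1) (by simp)
  have k3 := key Complex.I (by simp)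
  have k4 := key (-Complex.I) (by simp)
  -- On `|t| = 1` the cubic is a Laurent polynomial in `t` with exponents `-1, 0, 1, 2`, distinct
  -- mod 4, so averaging over the fourth roots of unity isolates the coefficient of `t`. The term `B
  -- B^* B = B` then cancels one `B`.
  have hAB : B * Aᴴ * A + A * Aᴴ * B = B := by
    have e1 : ∀ t : ℂ, star t * t = 1 → (A + t • B) * (A + t • B)ᴴ * (A + t • B)
        = (A * Aᴴ * A + B * Bᴴ * A + A * Bᴴ * B) + t • (B * Aᴴ * A + A * Aᴴ * B + B * Bᴴ * B)
          + star t • (A * Bᴴ * A) + (t * t) • (B * Aᴴ * B) := by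
      intro t ht
      have ht' : t * star t = 1 := by rw [mul_comm]; exact ht
      simp only [conjTranspose_add, conjTranspose_smul, add_mul, mul_add, Matrix.smul_mul,
        Matrix.mul_smul, smul_smul, smul_add]
      simp only [ht, ht', one_smul, mul_assoc, mul_one]
      module
    rw [e1 _ (by simp)] at k1 k2 k3 k4
    have : (4 : ℂ) • (B * Aᴴ * A + A * Aᴴ * B + B * Bᴴ * B) = (4 : ℂ) • ((2 : ℂ) • B) := by
      have k5 := congrArg₂ (· - ·) k1 k2
      have k6 := congrArg₂ (· - ·) k3 k4
      have k7 := congrArg₂ (fun X Y => X + (-Complex.I) • Y) k5 k6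
      simp only [Complex.star_def, Complex.conj_I, map_neg, map_one] at k7
      have hI : Complex.I * Complex.I = -1 := Complex.I_mul_I
      rw [show Complex.I * Complex.I = -1 from hI, show -Complex.I * -Complex.I = -1 by simp] at k7
      have l1 : ∀ X Y Z T : Matrix (Fin m) (Fin m) ℂ,
        X + (1 : ℂ) • Y + (1 : ℂ) • Z + ((1 : ℂ) * 1) • T
         - (X + (-1 : ℂ) • Y + (-1 : ℂ) • Z + ((-1 : ℂ) * -1) • T)
         + (-Complex.I) • (X + Complex.I • Y + (-Complex.I) • Z + (-1 : ℂ) • T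
           - (X + (-Complex.I) • Y + (- -Complex.I) • Z + (-1 : ℂ) • T)) = (4 : ℂ) • Y := by
        intro X Y Z T
        ext i j
        simp
        linear_combination (-2 * Y i j + 2 * Z i j) * hI
      rw [l1] at k7
      rw [k7]
      ext i j
      simp
      linear_combination (-4 * B i j) * hI
    have h4 := smul_right_injective _ (by norm_num : (4 : ℂ) ≠ 0) this
    rw [hpB, two_smul] at h4
    exact add_right_cancel h4
  -- Transposition reverses the product, and the four signs from skew symmetry cancel.
  have hsym : (A * Aᴴ * B * Bᴴ).trace = (B * Aᴴ * A * Bᴴ).trace := by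
    conv_lhs => rw [← trace_transpose]
    simp only [transpose_mul, hA, hB, conjTranspose_skew hA, conjTranspose_skew hB]
    rw [trace_mul_comm]
    simp [mul_assoc]
  have htot : (B * Aᴴ * A * Bᴴ).trace + (A * Aᴴ * B * Bᴴ).trace = (Bᴴ * B).trace := by
    rw [← trace_add, ← add_mul, hAB, trace_mul_comm]
  rw [hsym] at htot
  have h1 := trace_mul_projection_le hpA hcB
  have h2 := congrArg Complex.re htot
  rw [Complex.add_re] at h2
  rw [Fintype.card_fin] at h1
  have h3 : ((3 * (2 * (m / 2)) : ℕ) : ℝ) ≤ ((2 * m : ℕ) : ℝ) := by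
    push_cast at *
    linarith
  have h4 : 3 * (2 * (m / 2)) ≤ 2 * m := by exact_mod_cast h3
  omega

end SkewContractions

/-! ### The matrix ball and its invariant metric -/

noncomputable section MatrixBall

variable {p q r : Type*} [Fintype p] [Fintype q] [Fintype r] [DecidableEq p] [DecidableEq q]

/-- `(1 - Z^* Z)⁻¹`. -/
def rightDefect (Z : Matrix p q ℂ) : Matrix q q ℂ := (1 - Zᴴ * Z)⁻¹

/-- `(1 - Z Z^*)⁻¹`. -/
def leftDefect (Z : Matrix p q ℂ) : Matrix p p ℂ := (1 - Z * Zᴴ)⁻¹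

/-- `Re tr ((1 - Z^* Z)⁻¹ V^* (1 - Z Z^*)⁻¹ W)`. -/
def matrixMetric (Z V W : Matrix p q ℂ) : ℝ :=
  (trace (rightDefect Z * Vᴴ * leftDefect Z * W)).re

section Algebra

variable {Z : Matrix p q ℂ}

lemma rightDefect_mul (hZ : (1 - Zᴴ * Z).PosDef) : rightDefect Z * (1 - Zᴴ * Z) = 1 :=
  nonsing_inv_mul _ ((isUnit_iff_isUnit_det _).1 hZ.isUnit)

lemma mul_rightDefect (hZ : (1 - Zᴴ * Z).PosDef) : (1 - Zᴴ * Z) * rightDefect Z = 1 :=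
  mul_nonsing_inv _ ((isUnit_iff_isUnit_det _).1 hZ.isUnit)

/-- Only invertibility of `1 - Z^* Z` is used, not positivity, so that the formula also applies
outside the ball. -/
lemma leftDefect_eq_of_mul_eq_one {D : Matrix q q ℂ} (hD : (1 - Zᴴ * Z) * D = 1) :
    leftDefect Z = 1 + Z * D * Zᴴ := by
  refine inv_eq_right_inv ?_
  have h : (1 - Z * Zᴴ) * (1 + Z * D * Zᴴ)
      = 1 - Z * Zᴴ + Z * ((1 - Zᴴ * Z) * D) * Zᴴ := by
    simp only [Matrix.sub_mul, Matrix.mul_sub, Matrix.mul_add, Matrix.one_mul, Matrix.mul_one,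
      Matrix.mul_assoc]
  rw [h, hD, Matrix.mul_one, sub_add_cancel]

lemma leftDefect_eq (hZ : (1 - Zᴴ * Z).PosDef) :
    leftDefect Z = 1 + Z * rightDefect Z * Zᴴ :=
  leftDefect_eq_of_mul_eq_one (mul_rightDefect hZ)

lemma posDef_rightDefect (hZ : (1 - Zᴴ * Z).PosDef) : (rightDefect Z).PosDef := hZ.inv

lemma posDef_leftDefect (hZ : (1 - Zᴴ * Z).PosDef) : (leftDefect Z).PosDef := by
  rw [leftDefect_eq hZ]
  exact PosDef.one.add_posSemidef ((posDef_rightDefect hZ).posSemidef.mul_mul_conjTranspose_same Z)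

lemma posDef_one_sub_mul_conjTranspose (hZ : (1 - Zᴴ * Z).PosDef) : (1 - Z * Zᴴ).PosDef := by
  have h := posDef_leftDefect hZ
  rw [leftDefect] at h
  exact posDef_inv_iff.1 h

lemma mul_leftDefect (hZ : (1 - Zᴴ * Z).PosDef) : (1 - Z * Zᴴ) * leftDefect Z = 1 :=
  mul_nonsing_inv _ ((isUnit_iff_isUnit_det _).1 (posDef_one_sub_mul_conjTranspose hZ).isUnit)

lemma rightDefect_mul_conjTranspose (hZ : (1 - Zᴴ * Z).PosDef) :
    rightDefect Z * Zᴴ = Zᴴ * leftDefect Z := by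
  calc rightDefect Z * Zᴴ = rightDefect Z * (Zᴴ * ((1 - Z * Zᴴ) * leftDefect Z)) := by
        rw [mul_leftDefect hZ, Matrix.mul_one]
    _ = rightDefect Z * (1 - Zᴴ * Z) * Zᴴ * leftDefect Z := by
        simp only [Matrix.sub_mul, Matrix.mul_sub, Matrix.one_mul, Matrix.mul_one, Matrix.mul_assoc]
    _ = Zᴴ * leftDefect Z := by rw [rightDefect_mul hZ, Matrix.one_mul]

lemma mul_rightDefect_eq (hZ : (1 - Zᴴ * Z).PosDef) :
    Z * rightDefect Z = leftDefect Z * Z := by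
  have h := congrArg conjTranspose (rightDefect_mul_conjTranspose hZ)
  simpa only [conjTranspose_mul, conjTranspose_conjTranspose,
    (posDef_rightDefect hZ).isHermitian.eq, (posDef_leftDefect hZ).isHermitian.eq] using h

lemma rightDefect_eq (hZ : (1 - Zᴴ * Z).PosDef) :
    rightDefect Z = 1 + Zᴴ * leftDefect Z * Z := by
  rw [← rightDefect_mul_conjTranspose hZ]
  have := rightDefect_mul hZ
  rw [Matrix.mul_sub, Matrix.mul_one] at this
  rw [Matrix.mul_assoc, ← this, sub_add_cancel]

lemma exists_factor {P : Matrix q q ℂ} (hP : P.PosDef) : ∃ S : Matrix q q ℂ, P = Sᴴ * S := by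
  open scoped MatrixOrder in
  exact CStarAlgebra.nonneg_iff_eq_star_mul_self.mp hP.posSemidef.nonneg

/-- The factors transport `V` to the origin, where the metric is the Hilbert–Schmidt norm. -/
lemma matrixMetric_self_eq {S : Matrix p p ℂ} {R : Matrix q q ℂ} (hS : leftDefect Z = Sᴴ * S)
    (hR : rightDefect Z = Rᴴ * R) (V : Matrix p q ℂ) :
    matrixMetric Z V V = (((S * V * Rᴴ)ᴴ * (S * V * Rᴴ)).trace).re := by
  rw [matrixMetric, hS, hR]
  congr 1
  simp only [conjTranspose_mul, conjTranspose_conjTranspose]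
  conv_rhs => rw [← Matrix.mul_assoc, trace_mul_comm]
  simp only [Matrix.mul_assoc]

lemma matrixMetric_comm (hZ : (1 - Zᴴ * Z).PosDef) (V W : Matrix p q ℂ) :
    matrixMetric Z V W = matrixMetric Z W V := by
  unfold matrixMetric
  rw [← Complex.conj_re]
  congr 1
  rw [← Complex.star_def, ← trace_conjTranspose]
  simp only [conjTranspose_mul, conjTranspose_conjTranspose,
    (posDef_rightDefect hZ).isHermitian.eq, (posDef_leftDefect hZ).isHermitian.eq]
  conv_lhs => rw [← Matrix.mul_assoc, ← Matrix.mul_assoc, trace_mul_comm]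
  simp only [Matrix.mul_assoc]

lemma matrixMetric_sub_left (V V' W : Matrix p q ℂ) :
    matrixMetric Z (V - V') W = matrixMetric Z V W - matrixMetric Z V' W := by
  simp [matrixMetric, Matrix.mul_sub, Matrix.sub_mul]

lemma isUnit_factor {P S : Matrix q q ℂ} (hP : P.PosDef) (hS : P = Sᴴ * S) : IsUnit S := by
  have h := (isUnit_iff_isUnit_det _).1 hP.isUnit
  rw [hS, det_mul] at h
  exact (isUnit_iff_isUnit_det _).2 (isUnit_of_mul_isUnit_right h)

lemma matrixMetric_self_nonneg (hZ : (1 - Zᴴ * Z).PosDef) (V : Matrix p q ℂ) :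
    0 ≤ matrixMetric Z V V := by
  obtain ⟨S, hS⟩ := exists_factor (posDef_leftDefect hZ)
  obtain ⟨R, hR⟩ := exists_factor (posDef_rightDefect hZ)
  rw [matrixMetric_self_eq hS hR]
  exact (Complex.le_def.1 (posSemidef_conjTranspose_mul_self (S * V * Rᴴ)).trace_nonneg).1

lemma eq_zero_of_matrixMetric_self (hZ : (1 - Zᴴ * Z).PosDef) {V : Matrix p q ℂ}
    (h : matrixMetric Z V V = 0) : V = 0 := by
  obtain ⟨S, hS⟩ := exists_factor (posDef_leftDefect hZ)
  obtain ⟨R, hR⟩ := exists_factor (posDef_rightDefect hZ)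
  rw [matrixMetric_self_eq hS hR] at h
  have h0 := Complex.le_def.1 (posSemidef_conjTranspose_mul_self (S * V * Rᴴ)).trace_nonneg
  have h1 : ((S * V * Rᴴ)ᴴ * (S * V * Rᴴ)).trace = 0 := Complex.ext h h0.2.symm
  rw [trace_conjTranspose_mul_self_eq_zero_iff] at h1
  have hS' := (isUnit_iff_isUnit_det _).1 (isUnit_factor (posDef_leftDefect hZ) hS)
  have hR' : IsUnit Rᴴ.det := by
    have := (isUnit_iff_isUnit_det _).1 (isUnit_factor (posDef_rightDefect hZ) hR)
    rw [det_conjTranspose]; exact this.star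
  calc V = S⁻¹ * (S * V * Rᴴ) * Rᴴ⁻¹ := by
        rw [Matrix.mul_assoc S, nonsing_inv_mul_cancel_left _ _ hS',
          mul_nonsing_inv_cancel_right _ _ hR']
    _ = 0 := by rw [h1]; simp

end Algebra

/-! ### Derivatives of matrix-valued maps and of the metric -/

section Calculus

/-- `F` is Fréchet differentiable at `x`, with `F' u` its derivative in the direction `u`. -/
def HasDirectionalDeriv (𝕜 : Type*) [NontriviallyNormedField 𝕜] {E G : Type*}
    [NormedAddCommGroup E] [NormedSpace 𝕜 E] [NormedAddCommGroup G] [NormedSpace 𝕜 G]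
    (F F' : E → G) (x : E) : Prop :=
  ∃ L : E →L[𝕜] G, HasFDerivAt F L x ∧ ∀ u, L u = F' u

namespace HasDirectionalDeriv

variable {𝕜 : Type*} [NontriviallyNormedField 𝕜] {E G G₁ G₂ : Type*}
  [NormedAddCommGroup E] [NormedSpace 𝕜 E] [NormedAddCommGroup G] [NormedSpace 𝕜 G]
  [NormedAddCommGroup G₁] [NormedSpace 𝕜 G₁] [NormedAddCommGroup G₂] [NormedSpace 𝕜 G₂]
  {F F' : E → G} {x : E}

lemma fderiv_apply (h : HasDirectionalDeriv 𝕜 F F' x) (u : E) : fderiv 𝕜 F x u = F' u := by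
  obtain ⟨L, hL, hu⟩ := h
  rw [hL.fderiv, hu]

lemma differentiableAt (h : HasDirectionalDeriv 𝕜 F F' x) : DifferentiableAt 𝕜 F x :=
  h.choose_spec.1.differentiableAt

lemma of_differentiableAt (h : DifferentiableAt 𝕜 F x) :
    HasDirectionalDeriv 𝕜 F (fun u => fderiv 𝕜 F x u) x :=
  ⟨_, h.hasFDerivAt, fun _ => rfl⟩

lemma congr_right (h : HasDirectionalDeriv 𝕜 F F' x) {F'' : E → G} (h' : ∀ u, F' u = F'' u) :
    HasDirectionalDeriv 𝕜 F F'' x := by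
  rwa [← funext h']

lemma congr_left (h : HasDirectionalDeriv 𝕜 F F' x) {G : E → G} (h' : G =ᶠ[nhds x] F) :
    HasDirectionalDeriv 𝕜 G F' x := by
  obtain ⟨L, hL, hu⟩ := h
  exact ⟨L, hL.congr_of_eventuallyEq h', hu⟩

lemma const (c : G) (x : E) : HasDirectionalDeriv 𝕜 (fun _ : E => c) (fun _ => 0) x :=
  ⟨0, hasFDerivAt_const c x, fun _ => rfl⟩

lemma const_sub (c : G) (h : HasDirectionalDeriv 𝕜 F F' x) :
    HasDirectionalDeriv 𝕜 (fun y => c - F y) (fun u => -F' u) x := by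
  obtain ⟨L, hL, hu⟩ := h
  exact ⟨-L, hL.const_sub c, fun u => by simp [hu]⟩

lemma sub_const (c : G) (h : HasDirectionalDeriv 𝕜 F F' x) :
    HasDirectionalDeriv 𝕜 (fun y => F y - c) F' x := by
  obtain ⟨L, hL, hu⟩ := h
  exact ⟨L, hL.sub_const c, hu⟩

lemma add {F₁ F₁' : E → G} (h : HasDirectionalDeriv 𝕜 F F' x)
    (h₁ : HasDirectionalDeriv 𝕜 F₁ F₁' x) :
    HasDirectionalDeriv 𝕜 (fun y => F y + F₁ y) (fun u => F' u + F₁' u) x := by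
  obtain ⟨L, hL, hu⟩ := h
  obtain ⟨L₁, hL₁, hu₁⟩ := h₁
  exact ⟨L + L₁, hL.add hL₁, fun u => by simp [hu, hu₁]⟩

lemma clm (T : G →L[𝕜] G₁) (h : HasDirectionalDeriv 𝕜 F F' x) :
    HasDirectionalDeriv 𝕜 (fun y => T (F y)) (fun u => T (F' u)) x := by
  obtain ⟨L, hL, hu⟩ := h
  exact ⟨T.comp L, T.hasFDerivAt.comp x hL, fun u => by simp [hu]⟩

lemma bilinear (B : G →L[𝕜] G₁ →L[𝕜] G₂) {F₁ F₁' : E → G₁} (h : HasDirectionalDeriv 𝕜 F F' x)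
    (h₁ : HasDirectionalDeriv 𝕜 F₁ F₁' x) :
    HasDirectionalDeriv 𝕜 (fun y => B (F y) (F₁ y)) (fun u => B (F' u) (F₁ x) + B (F x) (F₁' u))
      x := by
  obtain ⟨L, hL, hu⟩ := h
  obtain ⟨L₁, hL₁, hu₁⟩ := h₁
  exact ⟨_, B.hasFDerivAt_of_bilinear hL hL₁, fun u => by simp [hu, hu₁, add_comm]⟩

lemma ringInverse {R : Type*} [NormedRing R] [CompleteSpace R] [NormedAlgebra 𝕜 R]
    {F F' : E → R} (h : HasDirectionalDeriv 𝕜 F F' x) (hF : IsUnit (F x)) :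
    HasDirectionalDeriv 𝕜 (fun y => Ring.inverse (F y))
      (fun u => -(Ring.inverse (F x) * F' u * Ring.inverse (F x))) x := by
  obtain ⟨L, hL, hu⟩ := h
  obtain ⟨U, hU⟩ := hF
  have h1 := hasFDerivAt_ringInverse (𝕜 := 𝕜) U
  rw [hU] at h1
  refine ⟨_, h1.comp x hL, fun u => ?_⟩
  rw [← hU, Ring.inverse_unit]
  simp [hu]

end HasDirectionalDeriv

/-- Matrix multiplication as a continuous bilinear map. -/
def mulBilin (𝕜 : Type*) [RCLike 𝕜] [NormedAlgebra 𝕜 ℂ] (p q r : Type*)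
    [Fintype p] [Fintype q] [Fintype r] :
    Matrix p q ℂ →L[𝕜] Matrix q r ℂ →L[𝕜] Matrix p r ℂ :=
  LinearMap.mkContinuous₂
    (LinearMap.mk₂ 𝕜 (fun A B => A * B) Matrix.add_mul (fun c A B => Matrix.smul_mul c A B)
      Matrix.mul_add (fun c A B => Matrix.mul_smul A c B)) 1
    (fun A B => by simpa using frobenius_norm_mul A B)

/-- The conjugate transpose as a continuous real linear map. -/
def conjTransposeCLM (p q : Type*) [Fintype p] [Fintype q] :
    Matrix p q ℂ →L[ℝ] Matrix q p ℂ :=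
  LinearMap.mkContinuous
    { toFun := conjTranspose
      map_add' := conjTranspose_add
      map_smul' := fun c A => by simp [conjTranspose_smul] } 1
    (fun A => by simp [frobenius_norm_conjTranspose])

/-- The real part of the trace as a continuous real linear functional. -/
def reTraceCLM (q : Type*) [Fintype q] : Matrix q q ℂ →L[ℝ] ℝ :=
  LinearMap.toContinuousLinearMap
    { toFun := fun A => A.trace.re
      map_add' := fun A B => by simp
      map_smul' := fun c A => by simp [trace_smul] }

namespace HasDirectionalDeriv

section Field

variable {𝕜 : Type*} [RCLike 𝕜] [NormedAlgebra 𝕜 ℂ]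
  {E : Type*} [NormedAddCommGroup E] [NormedSpace 𝕜 E] {x : E}

lemma matrixMul {F F' : E → Matrix p q ℂ} {G G' : E → Matrix q r ℂ}
    (hF : HasDirectionalDeriv 𝕜 F F' x) (hG : HasDirectionalDeriv 𝕜 G G' x) :
    HasDirectionalDeriv 𝕜 (fun y => F y * G y) (fun u => F' u * G x + F x * G' u) x :=
  bilinear (mulBilin 𝕜 p q r) hF hG

attribute [local instance] Matrix.frobeniusNormedRing Matrix.frobeniusNormedAlgebra in
lemma matrixInv {F F' : E → Matrix q q ℂ} (hF : HasDirectionalDeriv 𝕜 F F' x)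
    (hu : IsUnit (F x)) :
    HasDirectionalDeriv 𝕜 (fun y => (F y)⁻¹) (fun u => -((F x)⁻¹ * F' u * (F x)⁻¹)) x := by
  simp only [nonsing_inv_eq_ringInverse]
  exact ringInverse hF hu

end Field

variable {E : Type*} [NormedAddCommGroup E] [NormedSpace ℝ E] {x : E}
  {ζ ζ' : E → Matrix p q ℂ}

lemma conjTranspose (hζ : HasDirectionalDeriv ℝ ζ ζ' x) :
    HasDirectionalDeriv ℝ (fun y => (ζ y)ᴴ) (fun u => (ζ' u)ᴴ) x :=
  clm (conjTransposeCLM p q) hζ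

lemma rightDefect (hζ : HasDirectionalDeriv ℝ ζ ζ' x) (hZ : (1 - (ζ x)ᴴ * ζ x).PosDef) :
    HasDirectionalDeriv ℝ (fun y => rightDefect (ζ y))
      (fun u => Hermitian.rightDefect (ζ x) * ((ζ' u)ᴴ * ζ x + (ζ x)ᴴ * ζ' u)
        * Hermitian.rightDefect (ζ x)) x :=
  (((hζ.conjTranspose.matrixMul hζ).const_sub 1).matrixInv hZ.isUnit).congr_right fun u => by
    rw [Matrix.mul_neg, Matrix.neg_mul, neg_neg]; rfl

lemma leftDefect (hζ : HasDirectionalDeriv ℝ ζ ζ' x) (hZ : (1 - (ζ x)ᴴ * ζ x).PosDef) :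
    HasDirectionalDeriv ℝ (fun y => leftDefect (ζ y))
      (fun u => Hermitian.leftDefect (ζ x) * (ζ' u * (ζ x)ᴴ + ζ x * (ζ' u)ᴴ)
        * Hermitian.leftDefect (ζ x)) x :=
  (((hζ.matrixMul hζ.conjTranspose).const_sub 1).matrixInv
    (posDef_one_sub_mul_conjTranspose hZ).isUnit).congr_right fun u => by
    rw [Matrix.mul_neg, Matrix.neg_mul, neg_neg]; rfl

end HasDirectionalDeriv

/-- `A(Z) = (1 - Z^* Z)⁻¹ Z^*`. -/
def connectionFactor (Z : Matrix p q ℂ) : Matrix q p ℂ := rightDefect Z * Zᴴ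

/-- The Christoffel symbol `U A(Z) V + V A(Z) U` of the metric `matrixMetric`. -/
def matrixChristoffel (Z U V : Matrix p q ℂ) : Matrix p q ℂ :=
  U * connectionFactor Z * V + V * connectionFactor Z * U

namespace HasDirectionalDeriv

variable {E : Type*} [NormedAddCommGroup E] [NormedSpace ℝ E] {x : E}
  {ζ ζ' : E → Matrix p q ℂ}

lemma connectionFactor (hζ : HasDirectionalDeriv ℝ ζ ζ' x) (hZ : (1 - (ζ x)ᴴ * ζ x).PosDef) :
    HasDirectionalDeriv ℝ (fun y => connectionFactor (ζ y))
      (fun u => Hermitian.rightDefect (ζ x) * (ζ' u)ᴴ * Hermitian.leftDefect (ζ x)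
        + Hermitian.connectionFactor (ζ x) * ζ' u * Hermitian.connectionFactor (ζ x)) x := by
  refine ((hζ.rightDefect hZ).matrixMul hζ.conjTranspose).congr_right fun u => ?_
  rw [Hermitian.connectionFactor, leftDefect_eq hZ]
  simp only [Matrix.add_mul, Matrix.mul_add, Matrix.mul_assoc, Matrix.mul_one]
  abel

lemma matrixChristoffel (hζ : HasDirectionalDeriv ℝ ζ ζ' x) (hZ : (1 - (ζ x)ᴴ * ζ x).PosDef)
    (V W : Matrix p q ℂ) :
    HasDirectionalDeriv ℝ (fun y => matrixChristoffel (ζ y) V W)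
      (fun u => V * (Hermitian.rightDefect (ζ x) * (ζ' u)ᴴ * Hermitian.leftDefect (ζ x)
        + Hermitian.connectionFactor (ζ x) * ζ' u * Hermitian.connectionFactor (ζ x)) * W
        + W * (Hermitian.rightDefect (ζ x) * (ζ' u)ᴴ * Hermitian.leftDefect (ζ x)
        + Hermitian.connectionFactor (ζ x) * ζ' u * Hermitian.connectionFactor (ζ x)) * V) x := by
  have h := hζ.connectionFactor hZ
  exact ((((const V x).matrixMul h).matrixMul (const W x)).add
    (((const W x).matrixMul h).matrixMul (const V x))).congr_right fun u => by
      simp only [Matrix.zero_mul, Matrix.mul_zero, zero_add, add_zero]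

/-- Compatibility of the connection with the metric: the product rule gives four trace terms, which
the identities `D Z^* = Z^* H` and `Z D = H Z` for the two defects regroup. With the symmetry of
`matrixChristoffel`, this gives the Koszul formula. -/
lemma matrixMetric (hζ : HasDirectionalDeriv ℝ ζ ζ' x) (hZ : (1 - (ζ x)ᴴ * ζ x).PosDef)
    (V W : Matrix p q ℂ) :
    HasDirectionalDeriv ℝ (fun y => matrixMetric (ζ y) V W)
      (fun u => Hermitian.matrixMetric (ζ x) (Hermitian.matrixChristoffel (ζ x) (ζ' u) V) W
        + Hermitian.matrixMetric (ζ x) V (Hermitian.matrixChristoffel (ζ x) (ζ' u) W)) x := by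
  refine (clm (reTraceCLM q) ((((hζ.rightDefect hZ).matrixMul (const Vᴴ x)).matrixMul
    (hζ.leftDefect hZ)).matrixMul (const W x))).congr_right fun u => ?_
  change Complex.re (trace _) = _
  generalize ζ' u = U
  generalize ζ x = Z at *
  have hA := rightDefect_mul_conjTranspose hZ
  have hA' := mul_rightDefect_eq hZ
  simp only [Matrix.mul_zero, add_zero, Hermitian.matrixMetric,
    Hermitian.matrixChristoffel, Hermitian.connectionFactor, conjTranspose_add, conjTranspose_mul,
    conjTranspose_conjTranspose, (posDef_rightDefect hZ).isHermitian.eq]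
  rw [← Complex.add_re, ← trace_add]
  generalize Hermitian.rightDefect Z = D at *
  generalize Hermitian.leftDefect Z = H at *
  congr 1
  have hc : (D * Vᴴ * H * W * D * Zᴴ * U).trace = (D * Zᴴ * U * D * Vᴴ * H * W).trace := by
    rw [Matrix.mul_assoc (D * Vᴴ * H * W * D), Matrix.mul_assoc (D * Vᴴ * H * W),
      trace_mul_comm]
    simp only [Matrix.mul_assoc]
  have e1 : (D * (Uᴴ * Z + Zᴴ * U) * D * Vᴴ * H + D * Vᴴ * (H * (U * Zᴴ + Z * Uᴴ) * H)) * W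
      = D * Uᴴ * (Z * D) * Vᴴ * H * W + D * Zᴴ * U * D * Vᴴ * H * W
        + D * Vᴴ * H * U * (Zᴴ * H) * W + D * Vᴴ * (H * Z) * Uᴴ * H * W := by
    simp only [Matrix.add_mul, Matrix.mul_add, Matrix.mul_assoc]
    abel
  rw [e1, ← hA, ← hA', trace_add, trace_add, trace_add, ← hc]
  simp only [Matrix.add_mul, Matrix.mul_add, Matrix.mul_assoc, trace_add]
  ring

end HasDirectionalDeriv

end Calculus

end MatrixBall

/-! ### Curvature of metrics induced on stable subspaces -/

section CurvatureOfSubspaces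

variable {p q : Type*} [Fintype p] [Fintype q] [DecidableEq p] [DecidableEq q]
  {E : Type*} [NormedAddCommGroup E] [NormedSpace ℂ E] [FiniteDimensional ℂ E]

/-- The hypothesis `hg` is nondegeneracy at `x`; it identifies the vector picked by
`Classical.epsilon`. -/
lemma christoffel_eq {g : E → E → E → ℝ} {x u v Γ : E}
    (hg : ∀ a, (∀ w, g x a w = g x Γ w) → a = Γ)
    (hΓ : ∀ w, g x Γ w =
      (metricDeriv g x u v w + metricDeriv g x v u w - metricDeriv g x w u v) / 2) :
    christoffel g x u v = Γ := by
  refine hg _ fun w => ?_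
  rw [hΓ]
  exact Classical.epsilon_spec (p := fun Γ : E => ∀ w : E,
    g x Γ w = (metricDeriv g x u v w + metricDeriv g x v u w - metricDeriv g x w u v) / 2)
    ⟨Γ, hΓ⟩ w

lemma HasDirectionalDeriv.linearMap {F G G₁ : Type*} [NormedAddCommGroup F] [NormedSpace ℝ F]
    [NormedAddCommGroup G] [NormedSpace ℂ G] [FiniteDimensional ℂ G] [NormedAddCommGroup G₁]
    [NormedSpace ℂ G₁] {f f' : F → G} {x : F} (h : HasDirectionalDeriv ℝ f f' x) (T : G →ₗ[ℂ] G₁) :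
    HasDirectionalDeriv ℝ (fun y => T (f y)) (fun u => T (f' u)) x :=
  h.clm (LinearMap.toContinuousLinearMap (T.restrictScalars ℝ))

lemma hasDirectionalDeriv_linear (ι : E →ₗ[ℂ] Matrix p q ℂ) (x : E) :
    HasDirectionalDeriv ℝ (fun y => ι y) (fun u => ι u) x :=
  HasDirectionalDeriv.linearMap ⟨ContinuousLinearMap.id ℝ E, hasFDerivAt_id x, fun _ => rfl⟩ ι

lemma matrixChristoffel_comm (Z U V : Matrix p q ℂ) :
    matrixChristoffel Z U V = matrixChristoffel Z V U := by
  unfold matrixChristoffel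
  rw [add_comm]

variable {ι : E →ₗ[ℂ] Matrix p q ℂ} {g : E → E → E → ℝ}

lemma metricDeriv_eq (hg : ∀ x v w, g x v w = matrixMetric (ι x) (ι v) (ι w)) {x : E}
    (hx : (1 - (ι x)ᴴ * ι x).PosDef) (u v w : E) :
    metricDeriv g x u v w = matrixMetric (ι x) (matrixChristoffel (ι x) (ι u) (ι v)) (ι w)
      + matrixMetric (ι x) (ι v) (matrixChristoffel (ι x) (ι u) (ι w)) := by
  unfold metricDeriv
  simp only [hg]
  exact ((hasDirectionalDeriv_linear ι x).matrixMetric hx (ι v) (ι w)).fderiv_apply u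

/-- The Christoffel symbols of a metric induced by `matrixMetric` on a subspace that is stable
under `matrixChristoffel`. -/
lemma map_christoffel (hι : Function.Injective ι)
    (hg : ∀ x v w, g x v w = matrixMetric (ι x) (ι v) (ι w)) {x : E}
    (hx : (1 - (ι x)ᴴ * ι x).PosDef) {u v : E}
    (hr : matrixChristoffel (ι x) (ι u) (ι v) ∈ LinearMap.range ι) :
    ι (christoffel g x u v) = matrixChristoffel (ι x) (ι u) (ι v) := by
  obtain ⟨Γ, hΓ⟩ := hr
  rw [christoffel_eq (Γ := Γ) ?_ ?_, hΓ]
  · intro a ha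
    have h := ha (a - Γ)
    rw [hg, hg, ← sub_eq_zero, ← matrixMetric_sub_left, ← map_sub] at h
    exact sub_eq_zero.1 (hι ((eq_zero_of_matrixMetric_self hx h).trans (map_zero ι).symm))
  · intro w
    rw [metricDeriv_eq hg hx, metricDeriv_eq hg hx, metricDeriv_eq hg hx, hg, hΓ,
      matrixChristoffel_comm (ι x) (ι v) (ι u), matrixChristoffel_comm (ι x) (ι w) (ι u),
      matrixChristoffel_comm (ι x) (ι w) (ι v),
      matrixMetric_comm hx (ι v), matrixMetric_comm hx (ι u) (matrixChristoffel _ _ _)]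
    ring

lemma map_fderiv_christoffel (hι : Function.Injective ι)
    (hg : ∀ x v w, g x v w = matrixMetric (ι x) (ι v) (ι w)) {x : E}
    (hx : ∀ᶠ y in nhds x, (1 - (ι y)ᴴ * ι y).PosDef)
    (hr : ∀ y, (1 - (ι y)ᴴ * ι y).PosDef → ∀ u v,
      matrixChristoffel (ι y) (ι u) (ι v) ∈ LinearMap.range ι) (u v w : E) :
    ι (fderiv ℝ (fun y => christoffel g y v w) x u) =
      ι v * (rightDefect (ι x) * (ι u)ᴴ * leftDefect (ι x)
        + connectionFactor (ι x) * ι u * connectionFactor (ι x)) * ι w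
      + ι w * (rightDefect (ι x) * (ι u)ᴴ * leftDefect (ι x)
        + connectionFactor (ι x) * ι u * connectionFactor (ι x)) * ι v := by
  -- The left inverse `ρ` first shows that the Christoffel symbol is differentiable as an `E`-valued
  -- map; only then can `ι` be moved across `fderiv`, which would otherwise be a default `0`.
  obtain ⟨ρ, hρ⟩ := ι.exists_leftInverse_of_injective (LinearMap.ker_eq_bot.2 hι)
  have hρι : ∀ y, ρ (ι y) = y := fun y => LinearMap.congr_fun hρ y
  have h1 := (hasDirectionalDeriv_linear ι x).matrixChristoffel hx.self_of_nhds (ι v) (ι w)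
  have h2 : HasDirectionalDeriv ℝ (fun y => christoffel g y v w) _ x :=
    (h1.linearMap ρ).congr_left
      (hx.mono fun y hy => by
        dsimp only
        rw [← map_christoffel hι hg hy (hr y hy v w), hρι])
  have h3 := HasDirectionalDeriv.of_differentiableAt h2.differentiableAt
  have h4 : HasDirectionalDeriv ℝ (fun y => matrixChristoffel (ι y) (ι v) (ι w)) _ x :=
    (h3.linearMap ι).congr_left
      (hx.mono fun y hy => (map_christoffel hι hg hy (hr y hy v w)).symm)
  exact (h4.fderiv_apply u).symm.trans (h1.fderiv_apply u)

/-- The terms in `V A V A V` are complex multilinear in the tangent vectors and cancel. In the terms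
with `V^*`, conjugation turns `i` into `-i`, so they add up instead. -/
lemma curvature_identity (V : Matrix p q ℂ) (A : Matrix q p ℂ) (D : Matrix q q ℂ)
    (H : Matrix p p ℂ) :
    (Complex.I • V) * (D * Vᴴ * H + A * V * A) * (Complex.I • V)
      + (Complex.I • V) * (D * Vᴴ * H + A * V * A) * (Complex.I • V)
      - (V * (D * (Complex.I • V)ᴴ * H + A * (Complex.I • V) * A) * (Complex.I • V)
        + (Complex.I • V) * (D * (Complex.I • V)ᴴ * H + A * (Complex.I • V) * A) * V)
      + (V * A * ((Complex.I • V) * A * (Complex.I • V) + (Complex.I • V) * A * (Complex.I • V))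
        + ((Complex.I • V) * A * (Complex.I • V) + (Complex.I • V) * A * (Complex.I • V)) * A * V)
      - ((Complex.I • V) * A * (V * A * (Complex.I • V) + (Complex.I • V) * A * V)
        + (V * A * (Complex.I • V) + (Complex.I • V) * A * V) * A * (Complex.I • V))
      = (-4 : ℂ) • (V * (D * Vᴴ * H) * V) := by
  simp only [conjTranspose_smul, Matrix.smul_mul, Matrix.mul_smul, smul_smul, Matrix.mul_add,
    Matrix.add_mul, Complex.star_def, Complex.conj_I, smul_add, Matrix.mul_assoc,
    Complex.I_mul_I, mul_neg, neg_mul, neg_neg]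
  generalize V * (D * (Vᴴ * (H * V))) = X
  generalize V * (A * (V * (A * V))) = Y
  module

lemma matrixMetric_I_smul (Z V W : Matrix p q ℂ) :
    matrixMetric Z (Complex.I • V) (Complex.I • W) = matrixMetric Z V W := by
  simp [matrixMetric, conjTranspose_smul, smul_smul]

lemma matrixMetric_real_smul_right (Z V W : Matrix p q ℂ) (c : ℝ) :
    matrixMetric Z V ((c : ℂ) • W) = c * matrixMetric Z V W := by
  simp [matrixMetric]

lemma matrixMetric_self_I_smul {Z : Matrix p q ℂ} (hZ : (1 - Zᴴ * Z).PosDef) (V : Matrix p q ℂ) :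
    matrixMetric Z V (Complex.I • V) = 0 := by
  have h1 := matrixMetric_I_smul Z V (Complex.I • V)
  rw [matrixMetric_comm hZ, smul_smul, Complex.I_mul_I, neg_one_smul] at h1
  have h2 : matrixMetric Z (-V) (Complex.I • V) = -matrixMetric Z V (Complex.I • V) := by
    simp [matrixMetric]
  linarith

lemma map_riemannCurvature (hι : Function.Injective ι)
    (hg : ∀ x v w, g x v w = matrixMetric (ι x) (ι v) (ι w)) {x : E}
    (hx : ∀ᶠ y in nhds x, (1 - (ι y)ᴴ * ι y).PosDef)
    (hr : ∀ y, (1 - (ι y)ᴴ * ι y).PosDef → ∀ u v,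
      matrixChristoffel (ι y) (ι u) (ι v) ∈ LinearMap.range ι) (v : E) :
    ι (riemannCurvature g x v (Complex.I • v) (Complex.I • v)) =
      (-4 : ℂ) • (ι v * (rightDefect (ι x) * (ι v)ᴴ * leftDefect (ι x)) * ι v) := by
  have hZ := hx.self_of_nhds
  have hΓ : ∀ u w, ι (christoffel g x u w) = matrixChristoffel (ι x) (ι u) (ι w) := fun u w =>
    map_christoffel hι hg hZ (hr x hZ u w)
  rw [riemannCurvature, map_sub, map_add, map_sub, map_fderiv_christoffel hι hg hx hr,
    map_fderiv_christoffel hι hg hx hr, hΓ, hΓ, hΓ, hΓ, map_smul]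
  exact curvature_identity _ _ _ _

/-- The holomorphic sectional curvature of a metric induced by `matrixMetric` on a subspace that
is stable under `matrixChristoffel`. -/
lemma holSectionalCurvature_eq (hι : Function.Injective ι)
    (hg : ∀ x v w, g x v w = matrixMetric (ι x) (ι v) (ι w)) {x : E}
    (hx : ∀ᶠ y in nhds x, (1 - (ι y)ᴴ * ι y).PosDef)
    (hr : ∀ y, (1 - (ι y)ᴴ * ι y).PosDef → ∀ u v,
      matrixChristoffel (ι y) (ι u) (ι v) ∈ LinearMap.range ι) (v : E) :
    holSectionalCurvature g x v =
      -4 * (trace (rightDefect (ι x) * (ι v)ᴴ * leftDefect (ι x) * ι v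
        * (rightDefect (ι x) * (ι v)ᴴ * leftDefect (ι x) * ι v))).re
        / matrixMetric (ι x) (ι v) (ι v) ^ 2 := by
  have hZ := hx.self_of_nhds
  have h1 : g x (riemannCurvature g x v (Complex.I • v) (Complex.I • v)) v
      = -4 * (trace (rightDefect (ι x) * (ι v)ᴴ * leftDefect (ι x) * ι v
        * (rightDefect (ι x) * (ι v)ᴴ * leftDefect (ι x) * ι v))).re := by
    rw [hg, map_riemannCurvature hι hg hx hr, matrixMetric_comm hZ,
      show ((-4 : ℂ)) = ((-4 : ℝ) : ℂ) by push_cast; rfl, matrixMetric_real_smul_right,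
      matrixMetric]
    simp only [Matrix.mul_assoc]
  rw [holSectionalCurvature, sectionalCurvature, h1, hg x v v, hg x (Complex.I • v), hg x v,
    map_smul, matrixMetric_I_smul, matrixMetric_self_I_smul hZ]
  congr 1
  ring

/-- Positive definiteness is an open condition on Hermitian matrices. -/
lemma eventually_posDef {X : Type*} [TopologicalSpace X] {F : X → Matrix q q ℂ}
    (hF : Continuous F) (hH : ∀ x, (F x).IsHermitian) {x : X} (hx : (F x).PosDef) :
    ∀ᶠ y in nhds x, (F y).PosDef := by
  have hK := isCompact_sphere (0 : EuclideanSpace ℂ q) 1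
  have hc : Continuous fun z : X × EuclideanSpace ℂ q =>
      (star z.2.ofLp ⬝ᵥ (F z.1 *ᵥ z.2.ofLp)).re := by
    have : Continuous fun z : X × EuclideanSpace ℂ q => z.2.ofLp :=
      (PiLp.continuous_ofLp 2 _).comp continuous_snd
    exact Complex.continuous_re.comp
      (this.star.dotProduct ((hF.comp continuous_fst).matrix_mulVec this))
  have h := hK.eventually_forall_of_forall_eventually (x₀ := x)
    -- Positivity of the quadratic form is jointly open in the point and the vector, and compactness
    -- of the unit sphere makes it uniform in the vector.
    (P := fun y v => 0 < (star v.ofLp ⬝ᵥ (F y *ᵥ v.ofLp)).re) fun v hv => by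
      refine hc.continuousAt.eventually (lt_mem_nhds (hx.re_dotProduct_pos ?_))
      intro h0
      have : v = 0 := (WithLp.ofLp_eq_zero 2).1 h0
      simp [this] at hv
  refine h.mono fun y hy => PosDef.of_dotProduct_mulVec_pos (hH y) fun v hv => ?_
  have hn : ‖WithLp.toLp 2 v‖ ≠ 0 := by simpa using hv
  set c : ℝ := ‖WithLp.toLp 2 v‖ with hcdef
  have h1 := hy (((c⁻¹ : ℝ) : ℂ) • WithLp.toLp 2 v) (by
    rw [mem_sphere_zero_iff_norm, norm_smul, Complex.norm_real, norm_inv, ← hcdef,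
      Real.norm_of_nonneg (norm_nonneg _), inv_mul_cancel₀ hn])
  have h2 : (star v ⬝ᵥ (F y *ᵥ v)).im = 0 := (hH y).im_star_dotProduct_mulVec_self v
  refine Complex.lt_def.2 ⟨?_, h2.symm⟩
  simp only [WithLp.ofLp_smul, star_smul, mulVec_smul, smul_dotProduct, dotProduct_smul,
    smul_eq_mul, Complex.star_def, Complex.conj_ofReal, Complex.re_ofReal_mul] at h1
  have hc0 : 0 < c⁻¹ := inv_pos.2 (lt_of_le_of_ne (norm_nonneg _) (Ne.symm hn))
  exact (mul_pos_iff_of_pos_left hc0).1 ((mul_pos_iff_of_pos_left hc0).1 h1)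

end CurvatureOfSubspaces

/-! ### Complex hyperbolic space as matrices with one column -/

noncomputable section Ball

variable {n : ℕ}

/-- A vector of `ℂ^n` as a column. -/
def columnMap (n : ℕ) : EuclideanSpace ℂ (Fin n) →ₗ[ℂ] Matrix (Fin n) Unit ℂ where
  toFun z := replicateCol Unit z.ofLp
  map_add' _ _ := rfl
  map_smul' _ _ := rfl

lemma columnMap_apply (z : EuclideanSpace ℂ (Fin n)) (i : Fin n) (j : Unit) :
    columnMap n z i j = z i := rfl

lemma columnMap_injective : Function.Injective (columnMap n) := fun _ _ h =>
  PiLp.ext fun i => congrFun (congrFun h i) ()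

lemma columnMap_range (Z : Matrix (Fin n) Unit ℂ) : Z ∈ LinearMap.range (columnMap n) :=
  ⟨WithLp.toLp 2 fun i => Z i (), rfl⟩

lemma conjTranspose_columnMap_mul (v w : EuclideanSpace ℂ (Fin n)) :
    (columnMap n v)ᴴ * columnMap n w = inner ℂ v w • (1 : Matrix Unit Unit ℂ) := by
  ext i j
  simp [columnMap_apply, Matrix.mul_apply, PiLp.inner_apply, mul_comm]

lemma one_sub_columnMap (z : EuclideanSpace ℂ (Fin n)) :
    1 - (columnMap n z)ᴴ * columnMap n z = (1 - (‖z‖ : ℂ) ^ 2) • (1 : Matrix Unit Unit ℂ) := by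
  rw [conjTranspose_columnMap_mul, inner_self_eq_norm_sq_to_K, sub_smul, one_smul]
  rfl

lemma rightDefect_columnMap (z : EuclideanSpace ℂ (Fin n)) :
    rightDefect (columnMap n z) = (1 - (‖z‖ : ℂ) ^ 2)⁻¹ • (1 : Matrix Unit Unit ℂ) := by
  rw [rightDefect, one_sub_columnMap, inv_subsingleton]
  ext i j
  simp

lemma ballMetric_eq (z v w : EuclideanSpace ℂ (Fin n)) :
    ballMetric n z v w = matrixMetric (columnMap n z) (columnMap n v) (columnMap n w) := by
  rw [ballMetric, matrixMetric, rightDefect_columnMap]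
  -- On the unit sphere both sides vanish, by the conventions for division by zero and for the
  -- inverse of a singular matrix.
  by_cases h : 1 - (‖z‖ : ℂ) ^ 2 = 0
  · simp [h]
  have hD : (1 - (columnMap n z)ᴴ * columnMap n z) *
      ((1 - (‖z‖ : ℂ) ^ 2)⁻¹ • (1 : Matrix Unit Unit ℂ)) = 1 := by
    rw [one_sub_columnMap, Matrix.smul_mul, Matrix.mul_smul, smul_smul, mul_inv_cancel₀ h,
      one_smul, Matrix.one_mul]
  rw [leftDefect_eq_of_mul_eq_one hD]
  have e : ((1 - (‖z‖ : ℂ) ^ 2)⁻¹ • (1 : Matrix Unit Unit ℂ)) * (columnMap n v)ᴴ *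
      (1 + columnMap n z * ((1 - (‖z‖ : ℂ) ^ 2)⁻¹ • (1 : Matrix Unit Unit ℂ)) * (columnMap n z)ᴴ)
      * columnMap n w
      = (inner ℂ v w / (1 - (‖z‖ : ℂ) ^ 2)
        + inner ℂ v z * inner ℂ z w / (1 - (‖z‖ : ℂ) ^ 2) ^ 2) • (1 : Matrix Unit Unit ℂ) := by
    simp only [Matrix.smul_mul, Matrix.one_mul, Matrix.mul_smul, Matrix.mul_one, Matrix.mul_add,
      Matrix.add_mul]
    rw [conjTranspose_columnMap_mul, ← Matrix.mul_assoc, Matrix.mul_assoc,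
      conjTranspose_columnMap_mul, conjTranspose_columnMap_mul]
    simp only [Matrix.smul_mul, Matrix.one_mul, smul_smul, add_smul]
    congr 2
    · ring
    · rw [div_eq_mul_inv, ← inv_pow]; ring
  rw [e, trace_smul]
  simp

lemma posDef_columnMap {z : EuclideanSpace ℂ (Fin n)} (hz : z ∈ complexHyperbolic n) :
    (1 - (columnMap n z)ᴴ * columnMap n z).PosDef := by
  rw [one_sub_columnMap]
  refine PosDef.one.smul ?_
  rw [complexHyperbolic, mem_ball_zero_iff] at hz
  have : 0 < 1 - ‖z‖ ^ 2 := by nlinarith [norm_nonneg z]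
  exact_mod_cast this

/-- In the curvature formula the matrix under the trace is `1 × 1`, with real entry because `V` is
orthogonal to `i V`; hence `tr X² = (tr X)²` and the ratio is `1`. -/
lemma holSectionalCurvature_ball {z v : EuclideanSpace ℂ (Fin n)} (hz : z ∈ complexHyperbolic n)
    (hv : v ≠ 0) : holSectionalCurvature (ballMetric n) z v = -4 := by
  have hx : ∀ᶠ y in nhds z, (1 - (columnMap n y)ᴴ * columnMap n y).PosDef :=
    Filter.eventually_of_mem (Metric.isOpen_ball.mem_nhds hz) fun y hy => posDef_columnMap hy
  rw [holSectionalCurvature_eq columnMap_injective ballMetric_eq hx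
    fun y _ u v => columnMap_range _]
  have hpos : matrixMetric (columnMap n z) (columnMap n v) (columnMap n v) ≠ 0 := fun h =>
    hv (columnMap_injective ((eq_zero_of_matrixMetric_self (posDef_columnMap hz) h).trans
      (map_zero _).symm))
  have him := matrixMetric_self_I_smul (posDef_columnMap hz) (columnMap n v)
  rw [div_eq_iff (pow_ne_zero 2 hpos)]
  congr 1
  unfold matrixMetric at him ⊢
  rw [Matrix.mul_smul, trace_smul, smul_eq_mul, Complex.I_mul_re, neg_eq_zero] at him
  generalize rightDefect (columnMap n z) * (columnMap n v)ᴴ * leftDefect (columnMap n z)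
    * columnMap n v = X at *
  simp only [trace, diag_apply, Finset.univ_unique, Finset.sum_singleton, Matrix.mul_apply,
    Complex.mul_re] at him ⊢
  rw [him]
  ring

lemma sInf_holSectionalCurvatures_ball (hn : 0 < n) :
    sInf (holSectionalCurvatures (ballMetric n) (complexHyperbolic n)) = -4 := by
  have h : holSectionalCurvatures (ballMetric n) (complexHyperbolic n) = {-4} := by
    ext κ
    constructor
    · rintro ⟨x, hx, v, hv, rfl⟩
      exact holSectionalCurvature_ball hx hv
    · rintro rfl
      have h0 : (0 : EuclideanSpace ℂ (Fin n)) ∈ complexHyperbolic n := by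
        simp [complexHyperbolic]
      have hv : (EuclideanSpace.single ⟨0, hn⟩ 1 : EuclideanSpace ℂ (Fin n)) ≠ 0 := by simp
      exact ⟨0, h0, _, hv, (holSectionalCurvature_ball h0 hv).symm⟩
  rw [h, csInf_singleton]

end Ball

/-! ### The curvature bound for the domain of `SO*(2m)` -/

section SoStar

variable {p : Type*} [Fintype p] [DecidableEq p]

/-- The operator norm of a skew-symmetric matrix is at most `1/√2` times its Hilbert–Schmidt
norm. -/
lemma skew_posSemidef {K : Matrix p p ℂ} (hK : Kᵀ = -K) :
    (((Kᴴ * K).trace / 2) • (1 : Matrix p p ℂ) - Kᴴ * K).PosSemidef := by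
  have hstar : star (Kᴴ * K).trace = (Kᴴ * K).trace := by
    rw [← trace_conjTranspose, conjTranspose_mul, conjTranspose_conjTranspose]
  refine PosSemidef.of_dotProduct_mulVec_nonneg ?_ fun b => ?_
  · refine IsHermitian.sub ?_ (isHermitian_conjTranspose_mul_self K)
    rw [IsHermitian, conjTranspose_smul, conjTranspose_one, star_div₀, hstar]
    simp
  by_cases hb : b = 0
  · simp [hb]
  set γ := star b ⬝ᵥ b with hγ
  have hγ0 : 0 < γ := dotProduct_star_self_pos_iff.2 hb
  have hγs : star γ = γ := Complex.conj_eq_iff_im.2 (Complex.lt_def.1 hγ0).2.symm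
  set Q := vecMulVec b (star b) with hQ
  have hQQ : Q * Q = γ • Q := by
    rw [hQ, vecMulVec_mul_vecMulVec, vecMulVec_smul]
  have hQH : Qᴴ = Q := by rw [hQ, conjTranspose_vecMulVec, star_star]
  have hQTH : Qᵀᴴ = Qᵀ := by ext i j; simp [hQ, vecMulVec_apply, mul_comm]
  have hQTQT : Qᵀ * Qᵀ = γ • Qᵀ := by rw [← transpose_mul, hQQ, transpose_smul]
  have hbKb : b ⬝ᵥ (K *ᵥ b) = 0 := by
    have : b ⬝ᵥ (K *ᵥ b) = -(b ⬝ᵥ (K *ᵥ b)) := by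
      conv_lhs => rw [dotProduct_mulVec, ← mulVec_transpose, hK, neg_mulVec, neg_dotProduct,
        dotProduct_comm]
    exact self_eq_neg.1 this
  have hQKQ : Qᵀ * K * Q = 0 := by
    rw [hQ, transpose_vecMulVec, vecMulVec_mul, vecMulVec_mul_vecMulVec, ← dotProduct_mulVec, hbKb,
      zero_smul, vecMulVec_zero]
  set x := star b ⬝ᵥ ((Kᴴ * K) *ᵥ b) with hx
  have hx1 : (Kᴴ * K * Q).trace = x := by
    rw [hQ, mul_vecMulVec, trace_vecMulVec, dotProduct_comm]
  have hx2 : (Kᴴ * Qᵀ * K).trace = x := by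
    rw [← hx1, ← trace_transpose]
    simp only [transpose_mul, transpose_transpose, hK, conjTranspose_skew hK]
    rw [neg_mul, mul_neg, mul_neg, neg_neg, trace_mul_comm, Matrix.mul_assoc, trace_mul_comm]
  -- Up to the factor `γ`, this matrix is `K` compressed to the complements of `b` on the right and
  -- of its conjugate on the left; the doubly projected term is absent as `bᵀ K b = 0`. Its squared
  -- norm loses the contribution of `b` twice, whence the factor `2`.
  have hN := (posSemidef_conjTranspose_mul_self (γ • K - K * Q - Qᵀ * K)).trace_nonneg
  have e : ((γ • K - K * Q - Qᵀ * K)ᴴ * (γ • K - K * Q - Qᵀ * K)).trace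
      = γ * (γ * (Kᴴ * K).trace - 2 * x) := by
    have e1 : (γ • K - K * Q - Qᵀ * K)ᴴ * (γ • K - K * Q - Qᵀ * K)
      = (γ * γ) • (Kᴴ * K) - γ • (Kᴴ * K * Q) - (2 * γ) • (Kᴴ * Qᵀ * K) - γ • (Q * (Kᴴ * K))
        + Q * (Kᴴ * K * Q) + Q * Kᴴ * (Qᵀ * K) + Kᴴ * (Qᵀ * K * Q) + Kᴴ * (Qᵀ * Qᵀ) * K := by
      simp only [conjTranspose_sub, conjTranspose_smul, conjTranspose_mul, hQH, hQTH, hγs]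
      simp only [Matrix.sub_mul, Matrix.mul_sub, Matrix.smul_mul, Matrix.mul_smul,
        Matrix.mul_assoc]
      module
    have e2 : (Q * Kᴴ * (Qᵀ * K)).trace = 0 := by
      rw [Matrix.mul_assoc, trace_mul_comm, Matrix.mul_assoc, hQKQ, Matrix.mul_zero, trace_zero]
    have e3 : (Q * (Kᴴ * K * Q)).trace = γ * x := by
      rw [trace_mul_comm, Matrix.mul_assoc, hQQ, Matrix.mul_smul, trace_smul, hx1, smul_eq_mul]
    have e4 : (Q * (Kᴴ * K)).trace = x := by rw [trace_mul_comm, hx1]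
    rw [e1, hQKQ, hQTQT]
    simp only [trace_add, trace_sub, trace_smul, e2, e3, e4, hx1, Matrix.mul_zero, trace_zero,
      Matrix.mul_smul, Matrix.smul_mul, hx2, smul_eq_mul]
    ring
  rw [e] at hN
  have h2 : 0 ≤ γ * (Kᴴ * K).trace - 2 * x := by
    obtain ⟨hr, hi⟩ := Complex.lt_def.1 hγ0
    obtain ⟨hr', hi'⟩ := Complex.le_def.1 hN
    rw [Complex.mul_re, ← hi] at hr'
    rw [Complex.mul_im, ← hi] at hi'
    simp only [Complex.zero_re, Complex.zero_im, zero_mul, sub_zero, add_zero] at hr hr' hi'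
    exact Complex.le_def.2 ⟨(mul_nonneg_iff_of_pos_left hr).1 hr',
      ((mul_eq_zero.1 hi'.symm).resolve_left hr.ne').symm⟩
  have h3 : star b ⬝ᵥ ((((Kᴴ * K).trace / 2) • (1 : Matrix p p ℂ) - Kᴴ * K) *ᵥ b)
      = (γ * (Kᴴ * K).trace - 2 * x) * (1 / 2) := by
    rw [sub_mulVec, smul_mulVec, one_mulVec, dotProduct_sub, dotProduct_smul, ← hx, ← hγ,
      smul_eq_mul]
    ring
  rw [h3]
  exact mul_nonneg h2 (Complex.le_def.2 (by norm_num))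

/-- Compress the inequality `K^* K ≤ (tr K^* K / 2) 1` by `K` and take the trace. -/
lemma skew_trace_le {K : Matrix p p ℂ} (hK : Kᵀ = -K) :
    2 * (Kᴴ * K * (Kᴴ * K)).trace.re ≤ (Kᴴ * K).trace.re ^ 2 := by
  have h := ((skew_posSemidef hK).mul_mul_conjTranspose_same K).trace_nonneg
  have e : (K * (((Kᴴ * K).trace / 2) • (1 : Matrix p p ℂ) - Kᴴ * K) * Kᴴ).trace
      = (Kᴴ * K).trace * (Kᴴ * K).trace / 2 - (Kᴴ * K * (Kᴴ * K)).trace := by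
    rw [Matrix.mul_sub, Matrix.sub_mul, trace_sub, Matrix.mul_smul, Matrix.smul_mul, trace_smul,
      Matrix.mul_one, trace_mul_comm K, smul_eq_mul, trace_mul_comm _ Kᴴ]
    simp only [Matrix.mul_assoc]
    ring
  rw [e] at h
  have him : (Kᴴ * K).trace.im = 0 :=
    (Complex.le_def.1 (posSemidef_conjTranspose_mul_self K).trace_nonneg).2.symm
  have h1 := (Complex.le_def.1 h).1
  rw [Complex.sub_re, Complex.zero_re] at h1
  have h2 : ((Kᴴ * K).trace * (Kᴴ * K).trace / 2).re = (Kᴴ * K).trace.re ^ 2 / 2 := by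
    rw [show (2 : ℂ) = ((2 : ℝ) : ℂ) by norm_num, Complex.div_ofReal_re, Complex.mul_re, him]
    ring
  linarith

lemma rightDefect_skew {Z : Matrix p p ℂ} (hZ : Zᵀ = -Z) : rightDefect Z = (leftDefect Z)ᵀ := by
  rw [leftDefect, transpose_nonsing_inv, rightDefect, transpose_sub, transpose_one, transpose_mul,
    hZ, conjTranspose_skew hZ, neg_mul_neg]

/-- The two factorizations at a skew-symmetric matrix may be chosen conjugate. -/
lemma exists_skew_factor {Z : Matrix p p ℂ} (hZ : Zᵀ = -Z) (hp : (1 - Zᴴ * Z).PosDef) :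
    ∃ S : Matrix p p ℂ, leftDefect Z = Sᴴ * S ∧ rightDefect Z = Sᴴᵀᴴ * Sᴴᵀ ∧
      Sᴴᵀᴴ = Sᵀ := by
  obtain ⟨S, hS⟩ := exists_factor (posDef_leftDefect hp)
  have h : Sᴴᵀᴴ = Sᵀ := by ext i j; simp
  refine ⟨S, hS, ?_, h⟩
  rw [rightDefect_skew hZ, hS, transpose_mul, h]

/-- The factor `(1 - Z^* Z)⁻¹ Z^*` is itself skew, so the skew matrices are stable under the
connection and the curvature formula applies to them. -/
lemma matrixChristoffel_skew {Z U V : Matrix p p ℂ} (hZ : Zᵀ = -Z) (hp : (1 - Zᴴ * Z).PosDef)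
    (hU : Uᵀ = -U) (hV : Vᵀ = -V) :
    (matrixChristoffel Z U V)ᵀ = -matrixChristoffel Z U V := by
  have hA : (connectionFactor Z)ᵀ = -connectionFactor Z := by
    rw [connectionFactor, transpose_mul, conjTranspose_skew hZ, rightDefect_skew hZ,
      transpose_transpose, Matrix.neg_mul, ← rightDefect_mul_conjTranspose hp, rightDefect_skew hZ]
  simp only [matrixChristoffel, transpose_add, transpose_mul, hA, hU, hV]
  simp only [Matrix.neg_mul, Matrix.mul_neg, neg_neg, Matrix.mul_assoc]
  abel

lemma holSectionalCurvature_soStar {m : ℕ} {Z V : skewMatrices m} (hZ : Z ∈ soStarDomain m) :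
    -2 ≤ holSectionalCurvature (soStarMetric m) Z V := by
  have hx : ∀ᶠ Y in nhds Z,
      (1 - ((skewMatrices m).subtype Y)ᴴ * (skewMatrices m).subtype Y).PosDef := by
    refine eventually_posDef (F := fun Y : skewMatrices m =>
      1 - (Y : Matrix (Fin m) (Fin m) ℂ)ᴴ * (Y : Matrix (Fin m) (Fin m) ℂ)) ?_ (fun Y => ?_) hZ
    · have : Continuous fun Y : skewMatrices m => (Y : Matrix (Fin m) (Fin m) ℂ) :=
        continuous_subtype_val
      exact continuous_const.sub (this.matrix_conjTranspose.matrix_mul this)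
    · exact isHermitian_one.sub (isHermitian_conjTranspose_mul_self _)
  rw [holSectionalCurvature_eq (ι := (skewMatrices m).subtype) (g := soStarMetric m)
    Subtype.val_injective (fun _ _ _ => rfl) hx ?_]
  · have hZs : (Z : Matrix (Fin m) (Fin m) ℂ)ᵀ = -(Z : Matrix (Fin m) (Fin m) ℂ) := Z.2
    have hVs : (V : Matrix (Fin m) (Fin m) ℂ)ᵀ = -(V : Matrix (Fin m) (Fin m) ℂ) := V.2
    obtain ⟨S, hS, hR, hSR⟩ := exists_skew_factor hZs hZ
    simp only [Submodule.subtype_apply]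
    rw [matrixMetric_self_eq hS hR]
    set K := S * (V : Matrix (Fin m) (Fin m) ℂ) * Sᴴᵀᴴ with hKdef
    have hK : Kᵀ = -K := by
      rw [hKdef, hSR, transpose_mul, transpose_mul, transpose_transpose,
        hVs, Matrix.neg_mul, Matrix.mul_neg, Matrix.mul_assoc]
    have e : (rightDefect (Z : Matrix (Fin m) (Fin m) ℂ) * (V : Matrix (Fin m) (Fin m) ℂ)ᴴ
        * leftDefect (Z : Matrix (Fin m) (Fin m) ℂ) * V * (rightDefect (Z : Matrix (Fin m) (Fin m) ℂ) * (V : Matrix (Fin m) (Fin m) ℂ)ᴴ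
        * leftDefect (Z : Matrix (Fin m) (Fin m) ℂ) * V)).trace = (Kᴴ * K * (Kᴴ * K)).trace := by
      rw [hS, hR, hKdef]
      simp only [conjTranspose_mul, conjTranspose_conjTranspose]
      conv_lhs => rw [Matrix.mul_assoc Sᴴᵀᴴ, Matrix.mul_assoc Sᴴᵀᴴ, Matrix.mul_assoc Sᴴᵀᴴ,
        Matrix.mul_assoc Sᴴᵀᴴ, trace_mul_comm]
      simp only [Matrix.mul_assoc]
    rw [e]
    have h := skew_trace_le hK
    -- The first case is `K = 0`, where the quotient is `0` by convention; thus `V ≠ 0` need not be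
    -- assumed.
    rcases eq_or_lt_of_le (sq_nonneg (Kᴴ * K).trace.re) with h0 | h0
    · rw [← h0, div_zero]; norm_num
    · rw [le_div_iff₀ h0]
      linarith
  · intro Y hY U V
    exact ⟨⟨_, matrixChristoffel_skew Y.2 hY U.2 V.2⟩, rfl⟩

/-- An upper bound for the normalizing factor suffices: it turns the form equation into a lower
bound for the trace. -/
lemma neg_sInf_holSectionalCurvatures_soStar_le (m : ℕ) :
    -sInf (holSectionalCurvatures (soStarMetric m) (soStarDomain m)) ≤ 2 := by
  -- The condition `-2 ≤ 0` covers an empty set of curvatures, whose `sInf` is `0`.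
  refine neg_le.1 (Real.le_sInf ?_ (by norm_num))
  rintro κ ⟨Z, hZ, V, -, rfl⟩
  exact holSectionalCurvature_soStar hZ

end SoStar

/-! ### Möbius transformations and the Schwarz lemma -/

section SchwarzLemma

variable {p q : Type*} [Fintype p] [Fintype q] [DecidableEq p] [DecidableEq q]

lemma star_dotProduct_self_eq (y : q → ℂ) : star y ⬝ᵥ y = ((‖WithLp.toLp 2 y‖ ^ 2 : ℝ) : ℂ) := by
  have h := inner_self_eq_norm_sq_to_K (𝕜 := ℂ) (WithLp.toLp 2 y)
  rw [EuclideanSpace.inner_eq_star_dotProduct, dotProduct_comm] at h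
  rw [Complex.ofReal_pow]
  exact h

lemma posSemidef_one_sub_iff {K : Matrix p q ℂ} :
    (1 - Kᴴ * K).PosSemidef ↔
      ∀ y : q → ℂ, ‖WithLp.toLp 2 (K *ᵥ y)‖ ≤ ‖WithLp.toLp 2 y‖ := by
  have key : ∀ y : q → ℂ, star y ⬝ᵥ ((1 - Kᴴ * K) *ᵥ y)
      = ((‖WithLp.toLp 2 y‖ ^ 2 - ‖WithLp.toLp 2 (K *ᵥ y)‖ ^ 2 : ℝ) : ℂ) := by
    intro y
    rw [Complex.ofReal_sub, ← star_dotProduct_self_eq, ← star_dotProduct_self_eq, sub_mulVec,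
      one_mulVec, dotProduct_sub, star_mulVec, ← mulVec_mulVec, dotProduct_mulVec (star y) Kᴴ]
  have hle : ∀ y : q → ℂ, 0 ≤ star y ⬝ᵥ ((1 - Kᴴ * K) *ᵥ y) ↔
      ‖WithLp.toLp 2 (K *ᵥ y)‖ ≤ ‖WithLp.toLp 2 y‖ := fun y => by
    rw [key, Complex.zero_le_real, sub_nonneg, sq_le_sq₀ (norm_nonneg _) (norm_nonneg _)]
  constructor
  · exact fun h y => (hle y).1 (h.dotProduct_mulVec_nonneg y)
  · exact fun h => PosSemidef.of_dotProduct_mulVec_nonneg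
      (isHermitian_one.sub (isHermitian_conjTranspose_mul_self K)) fun y => (hle y).2 (h y)

/-- The matrix form of `|1 - z̄ w|² - |w - z|² = (1 - |z|²)(1 - |w|²)`. It gives both the
invertibility of `1 - Z^* W` and the contractivity of the Möbius map. -/
lemma moebius_identity {Z : Matrix p q ℂ} (hZ : (1 - Zᴴ * Z).PosDef) (W : Matrix p q ℂ) :
    (1 - Zᴴ * W)ᴴ * rightDefect Z * (1 - Zᴴ * W) - (W - Z)ᴴ * leftDefect Z * (W - Z)
      = 1 - Wᴴ * W := by
  have h1 := rightDefect_eq hZ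
  have h2 := leftDefect_eq hZ
  have h3 := rightDefect_mul_conjTranspose hZ
  have h4 := mul_rightDefect_eq hZ
  have e1 : (1 - Zᴴ * W)ᴴ * rightDefect Z * (1 - Zᴴ * W)
      = rightDefect Z - Wᴴ * (Z * rightDefect Z) - (rightDefect Z * Zᴴ) * W
        + Wᴴ * (Z * rightDefect Z * Zᴴ) * W := by
    simp only [conjTranspose_sub, conjTranspose_one, conjTranspose_mul, conjTranspose_conjTranspose,
      Matrix.sub_mul, Matrix.mul_sub, Matrix.one_mul, Matrix.mul_one, Matrix.mul_assoc]
    abel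
  have e2 : (W - Z)ᴴ * leftDefect Z * (W - Z)
      = Wᴴ * leftDefect Z * W - Wᴴ * (leftDefect Z * Z) - (Zᴴ * leftDefect Z) * W
        + Zᴴ * leftDefect Z * Z := by
    simp only [conjTranspose_sub, Matrix.sub_mul, Matrix.mul_sub, Matrix.mul_assoc]
    abel
  rw [e1, e2, h3, ← h4, eq_sub_of_add_eq' h1.symm, eq_sub_of_add_eq' h2.symm]
  simp only [Matrix.sub_mul, Matrix.mul_sub, Matrix.mul_one]
  abel

lemma isUnit_one_sub {Z W : Matrix p q ℂ} (hZ : (1 - Zᴴ * Z).PosDef) (hW : (1 - Wᴴ * W).PosDef) :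
    IsUnit (1 - Zᴴ * W) := by
  have h := hW.add_posSemidef
    ((posDef_leftDefect hZ).posSemidef.conjTranspose_mul_mul_same (W - Z))
  rw [← moebius_identity hZ, sub_add_cancel] at h
  have hu := (isUnit_iff_isUnit_det _).1 h.isUnit
  rw [det_mul] at hu
  exact (isUnit_iff_isUnit_det _).2 (isUnit_of_mul_isUnit_right hu)

/-- The Möbius transformation of the matrix ball that takes `Z` to `0` is contractive. -/
lemma posSemidef_moebius {Z W : Matrix p q ℂ} (hZ : (1 - Zᴴ * Z).PosDef)
    (hW : (1 - Wᴴ * W).PosDef) {S : Matrix p p ℂ} {R : Matrix q q ℂ} (hS : leftDefect Z = Sᴴ * S)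
    (hR : rightDefect Z = Rᴴ * R) :
    (1 - (S * ((W - Z) * (1 - Zᴴ * W)⁻¹) * R⁻¹)ᴴ
      * (S * ((W - Z) * (1 - Zᴴ * W)⁻¹) * R⁻¹)).PosSemidef := by
  have hRu := (isUnit_iff_isUnit_det _).1 (isUnit_factor (posDef_rightDefect hZ) hR)
  have hXu := (isUnit_iff_isUnit_det _).1 (isUnit_one_sub hZ hW)
  have h := hW.posSemidef.conjTranspose_mul_mul_same ((1 - Zᴴ * W)⁻¹ * R⁻¹)
  rw [← moebius_identity hZ, hS, hR] at h
  convert h using 1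
  have h1 : R * ((1 - Zᴴ * W) * ((1 - Zᴴ * W)⁻¹ * R⁻¹)) = 1 := by
    rw [mul_nonsing_inv_cancel_left _ _ hXu, mul_nonsing_inv _ hRu]
  have h2 : ((1 - Zᴴ * W)⁻¹ * R⁻¹)ᴴ * ((1 - Zᴴ * W)ᴴ * (Rᴴ * R) * (1 - Zᴴ * W))
      * ((1 - Zᴴ * W)⁻¹ * R⁻¹) = 1 := by
    calc _ = (R * ((1 - Zᴴ * W) * ((1 - Zᴴ * W)⁻¹ * R⁻¹)))ᴴ
          * (R * ((1 - Zᴴ * W) * ((1 - Zᴴ * W)⁻¹ * R⁻¹))) := by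
          generalize 1 - Zᴴ * W = X
          simp only [conjTranspose_mul, Matrix.mul_assoc]
      _ = 1 := by rw [h1, conjTranspose_one, Matrix.one_mul]
  rw [Matrix.mul_sub ((1 - Zᴴ * W)⁻¹ * R⁻¹)ᴴ, Matrix.sub_mul (((1 - Zᴴ * W)⁻¹ * R⁻¹)ᴴ * _), h2]
  congr 1
  generalize (1 - Zᴴ * W)⁻¹ = Y
  generalize W - Z = X
  simp only [conjTranspose_mul, Matrix.mul_assoc]

/-- The Schwarz lemma for holomorphic maps from a unit ball to the matrix ball. -/
lemma posSemidef_of_hasDirectionalDeriv {E : Type*} [NormedAddCommGroup E] [NormedSpace ℂ E]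
    {F F' : E → Matrix p q ℂ} (hF : ∀ z ∈ Metric.ball (0 : E) 1,
      ∃ G' : E → Matrix p q ℂ, HasDirectionalDeriv ℂ F G' z)
    (hF' : HasDirectionalDeriv ℂ F F' 0)
    (hp : ∀ z ∈ Metric.ball (0 : E) 1, (1 - (F z)ᴴ * F z).PosDef)
    {S : Matrix p p ℂ} {R : Matrix q q ℂ} (hS : leftDefect (F 0) = Sᴴ * S)
    (hR : rightDefect (F 0) = Rᴴ * R) {v : E} (hv : ‖v‖ ≤ 1) :
    (1 - (S * F' v * Rᴴ)ᴴ * (S * F' v * Rᴴ)).PosSemidef := by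
  have h0 : (0 : E) ∈ Metric.ball (0 : E) 1 := by simp
  have hZ := hp 0 h0
  set Z := F 0 with hZdef
  have hRu := (isUnit_iff_isUnit_det _).1 (isUnit_factor (posDef_rightDefect hZ) hR)
  -- Applying the matrices to a fixed `y` replaces the operator norm by a Euclidean norm, to which
  -- the vector-valued Schwarz lemma applies.
  rw [posSemidef_one_sub_iff]
  intro y
  let T : Matrix p q ℂ →ₗ[ℂ] EuclideanSpace ℂ p :=
    { toFun := fun M => WithLp.toLp 2 (M *ᵥ y)
      map_add' := fun M N => by rw [add_mulVec]; rfl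
      map_smul' := fun c M => by rw [smul_mulVec]; rfl }
  have hd : ∀ z ∈ Metric.ball (0 : E) 1, ∀ G' : E → Matrix p q ℂ, HasDirectionalDeriv ℂ F G' z →
      HasDirectionalDeriv ℂ (fun z => T (S * ((F z - Z) * (1 - Zᴴ * F z)⁻¹) * R⁻¹))
        (fun u => T (S * (G' u * (1 - Zᴴ * F z)⁻¹ + (F z - Z) *
          -((1 - Zᴴ * F z)⁻¹ * -(Zᴴ * G' u) * (1 - Zᴴ * F z)⁻¹)) * R⁻¹)) z := by
    intro z hz G' hG
    have h1 : HasDirectionalDeriv ℂ (fun z => (1 - Zᴴ * F z)⁻¹) _ z :=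
      ((((HasDirectionalDeriv.const Zᴴ z).matrixMul hG).const_sub 1)).matrixInv
        (isUnit_one_sub hZ (hp z hz))
    have h2 := ((HasDirectionalDeriv.const S z).matrixMul
      ((hG.sub_const Z).matrixMul h1)).matrixMul (HasDirectionalDeriv.const R⁻¹ z)
    refine (HasDirectionalDeriv.clm (LinearMap.toContinuousLinearMap T) h2).congr_right fun u => ?_
    simp only [Matrix.zero_mul, Matrix.mul_zero, zero_add, add_zero]
    rfl
  have hdiff : DifferentiableOn ℂ (fun z => T (S * ((F z - Z) * (1 - Zᴴ * F z)⁻¹) * R⁻¹))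
      (Metric.ball 0 1) := fun z hz => by
    obtain ⟨G', hG⟩ := hF z hz
    exact (hd z hz G' hG).differentiableAt.differentiableWithinAt
  have hmaps : Set.MapsTo (fun z => T (S * ((F z - Z) * (1 - Zᴴ * F z)⁻¹) * R⁻¹))
      (Metric.ball 0 1) (Metric.closedBall
        ((fun z => T (S * ((F z - Z) * (1 - Zᴴ * F z)⁻¹) * R⁻¹)) 0) ‖WithLp.toLp 2 y‖) := by
    intro z hz
    have e : (fun z => T (S * ((F z - Z) * (1 - Zᴴ * F z)⁻¹) * R⁻¹)) 0 = 0 := by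
      simp [← hZdef]
    rw [e, mem_closedBall_zero_iff]
    exact posSemidef_one_sub_iff.1 (posSemidef_moebius hZ (hp z hz) hS hR) y
  have hb := Complex.norm_fderiv_le_div_of_mapsTo_ball hdiff hmaps one_pos
  rw [div_one] at hb
  -- At `0` the factor `F z - Z` vanishes, leaving `S (F' v) (1 - Z^* Z)⁻¹ R⁻¹`, and `(1 - Z^* Z)⁻¹
  -- = R^* R`.
  have hval := (hd 0 h0 F' hF').fderiv_apply v
  have e : S * (F' v * (1 - Zᴴ * F 0)⁻¹ + (F 0 - Z) *
          -((1 - Zᴴ * F 0)⁻¹ * -(Zᴴ * F' v) * (1 - Zᴴ * F 0)⁻¹)) * R⁻¹ = S * F' v * Rᴴ := by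
    rw [← hZdef, sub_self, Matrix.zero_mul, add_zero]
    change S * (F' v * rightDefect Z) * R⁻¹ = _
    rw [hR]
    simp only [Matrix.mul_assoc]
    rw [mul_nonsing_inv _ hRu, Matrix.mul_one]
  rw [e] at hval
  calc ‖WithLp.toLp 2 ((S * F' v * Rᴴ) *ᵥ y)‖ = ‖T (S * F' v * Rᴴ)‖ := rfl
    _ ≤ ‖WithLp.toLp 2 y‖ * ‖v‖ := by
      rw [← hval]
      exact (ContinuousLinearMap.le_opNorm _ _).trans
        (mul_le_mul_of_nonneg_right hb (norm_nonneg _))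
    _ ≤ ‖WithLp.toLp 2 y‖ := mul_le_of_le_one_right (norm_nonneg _) hv

end SchwarzLemma

/-! ### The form equation on complex lines and the conclusion -/

lemma pullback_kahlerForm_I_smul {E G : Type*} [NormedAddCommGroup E] [NormedSpace ℂ E]
    [NormedAddCommGroup G] [NormedSpace ℂ G] (g : G → G → G → ℝ) {f : E → G} {x : E}
    (hf : DifferentiableAt ℂ f x) (v : E) :
    pullback f (kahlerForm g) x v (Complex.I • v) =
      g (f x) (Complex.I • fderiv ℂ f x v) (Complex.I • fderiv ℂ f x v) := by
  have h : ∀ u, fderiv ℝ f x u = fderiv ℂ f x u := fun u => by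
    rw [hf.fderiv_restrictScalars ℝ]; rfl
  rw [pullback, kahlerForm, h, h, map_smul]

end Hermitian

theorem proposition5p6 (n m : ℕ) (hn : 2 ≤ n) (hm : 4 ≤ m) :
    ¬ ∃ f : EuclideanSpace ℂ (Fin n) → Hermitian.skewMatrices m,
      Set.MapsTo f (Hermitian.complexHyperbolic n) (Hermitian.soStarDomain m) ∧
      DifferentiableOn ℂ f (Hermitian.complexHyperbolic n) ∧
      ∀ z ∈ Hermitian.complexHyperbolic n, ∀ v w : EuclideanSpace ℂ (Fin n),
        Hermitian.pullback f (Hermitian.soStarForm m) z v w =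
          ((m / 2 : ℕ) : ℝ) * Hermitian.hyperbolicForm n z v w := by
  open Hermitian in
  rintro ⟨f, hmaps, hdiff, hform⟩
  have h0 : (0 : EuclideanSpace ℂ (Fin n)) ∈ complexHyperbolic n := by simp [complexHyperbolic]
  have hat : ∀ z ∈ complexHyperbolic n, DifferentiableAt ℂ f z := fun z hz =>
    (hdiff z hz).differentiableAt (Metric.isOpen_ball.mem_nhds hz)
  let F : EuclideanSpace ℂ (Fin n) → Matrix (Fin m) (Fin m) ℂ := fun z => f z
  let F' : EuclideanSpace ℂ (Fin n) → EuclideanSpace ℂ (Fin n) → Matrix (Fin m) (Fin m) ℂ :=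
    fun z v => fderiv ℂ f z v
  have hF : ∀ z ∈ complexHyperbolic n, HasDirectionalDeriv ℂ F (F' z) z := fun z hz =>
    HasDirectionalDeriv.clm (skewMatrices m).subtypeL
      (HasDirectionalDeriv.of_differentiableAt (hat z hz))
  have hZ : (1 - (F 0)ᴴ * F 0).PosDef := hmaps h0
  obtain ⟨S, hS, hR, hSR⟩ := exists_skew_factor (show (F 0)ᵀ = -F 0 from (f 0).2) hZ
  let K : EuclideanSpace ℂ (Fin n) →ₗ[ℂ] Matrix (Fin m) (Fin m) ℂ :=
    { toFun := fun v => S * F' 0 v * Sᴴᵀᴴ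
      map_add' := fun v w => by simp [F', Matrix.mul_add, Matrix.add_mul]
      map_smul' := fun c v => by simp [F'] }
  have hK : ∀ v, (K v)ᵀ = -K v := fun v => by
    have hV : (F' 0 v)ᵀ = -F' 0 v := (fderiv ℂ f 0 v).2
    change (S * F' 0 v * Sᴴᵀᴴ)ᵀ = -(S * F' 0 v * Sᴴᵀᴴ)
    rw [hSR, transpose_mul, transpose_mul, transpose_transpose, hV, Matrix.neg_mul, Matrix.mul_neg,
      Matrix.mul_assoc]
  have hcontr : ∀ v, ‖v‖ = 1 → (1 - (K v)ᴴ * K v).PosSemidef := fun v hv =>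
    posSemidef_of_hasDirectionalDeriv (fun z hz => ⟨_, hF z hz⟩) (hF 0 h0) (fun z hz => hmaps hz)
      hS hR hv.le
  have htrace : ∀ v, ‖v‖ = 1 → ((2 * (m / 2) : ℕ) : ℝ) ≤ ((K v)ᴴ * K v).trace.re := by
    intro v hv
    have h := hform 0 h0 v (Complex.I • v)
    -- The value `4` is the factor that normalizes the ball metric from curvature `-4` to `-1`.
    have hR1 : hyperbolicForm n 0 v (Complex.I • v) = 4 := by
      rw [hyperbolicForm, kahlerForm, normalizedMetric,
        sInf_holSectionalCurvatures_ball (by omega)]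
      simp [ballMetric, inner_self_eq_norm_sq_to_K, norm_smul, hv]
    have hL1 : pullback f (soStarForm m) 0 v (Complex.I • v)
        = -sInf (holSectionalCurvatures (soStarMetric m) (soStarDomain m))
          * matrixMetric (F 0) (F' 0 v) (F' 0 v) := by
      rw [soStarForm, pullback_kahlerForm_I_smul _ (hat 0 h0), normalizedMetric,
        ← matrixMetric_I_smul]
      rfl
    rw [hR1, hL1] at h
    -- The left side equals `4 ⌊m/2⌋` by `h`, so the trace is at least `2 ⌊m/2⌋`.
    have h2 := mul_le_mul_of_nonneg_right (neg_sInf_holSectionalCurvatures_soStar_le m)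
      (matrixMetric_self_nonneg hZ (F' 0 v))
    rw [h, matrixMetric_self_eq hS hR] at h2
    change _ ≤ ((S * F' 0 v * Sᴴᵀᴴ)ᴴ * (S * F' 0 v * Sᴴᵀᴴ)).trace.re
    push_cast at h2 ⊢
    linarith
  -- The assumption `2 ≤ n` provides these two orthonormal vectors.
  let e₀ : EuclideanSpace ℂ (Fin n) := EuclideanSpace.single ⟨0, by omega⟩ 1
  let e₁ : EuclideanSpace ℂ (Fin n) := EuclideanSpace.single ⟨1, by omega⟩ 1
  have hnorm : ∀ a b : ℂ, ‖a‖ ^ 2 + ‖b‖ ^ 2 = 1 → ‖a • e₀ + b • e₁‖ = 1 := by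
    intro a b hab
    have horth : inner ℂ (a • e₀) (b • e₁) = 0 := by
      simp [e₀, e₁, EuclideanSpace.inner_single_left]
    have h := norm_add_sq_eq_norm_sq_add_norm_sq_of_inner_eq_zero (𝕜 := ℂ) _ _ horth
    rw [norm_smul, norm_smul] at h
    simp only [e₀, e₁, PiLp.norm_single, norm_one, mul_one] at h
    nlinarith [norm_nonneg (a • e₀ + b • e₁)]
  refine no_maximal_skew_pencil hm (hK e₀) (hK e₁) (fun a b hab => ?_) (fun a b hab => ?_)
  · rw [← map_smul, ← map_smul, ← map_add]
    exact hcontr _ (hnorm a b hab)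
  · rw [← map_smul, ← map_smul, ← map_add]
    exact htrace _ (hnorm a b hab)
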